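/- **Corollary 3.2.** Let $n\ge 2$ and let $A=(a_{ij})_{i,j=0}^n$ be a matrix of nonnegative integers, invertible over $\mathbb Q$. Put $F_A=\sum_{i}\prod_{j}x_j^{a_{ij}}$ and $F_{A^T}=\sum_i\prod_j X_j^{a_{ji}}$. Let $d$ be a positive integer such that $B=(b_{ij}):=dA^{-1}$ has integer entries, and put $q_i=\sum_j b_{ij}$, $r_j=\sum_i b_{ij}$, so that $\sum_j a_{ij}q_j=d$ for all $i$. Assume that all $q_i$ are positive, that the hypersurface $\{F_A=0\}\subset\mathbb C^{n+1}$ is singular at the origin and nowhere else, and that $\sum_i q_i=d$ (the Calabi–Yau condition). Let $X_A=\{F_A=0\}\subset W\mathbb P^n(q_0,\dots,q_n)$. For an exponent matrix $M$ such that $F_M$ is quasihomogeneous for given positive weights, let $\mathrm{Aut}(F_M)$ be the group of those $\lambda\in(\mathbb C^*)^{n+1}$ with $F_M(\lambda_0x_0,\dots,\lambda_nx_n)=F_M(x)$ for all $x$, let $SL(F_M)$ be its subgroup where $\prod_j\lambda_j=1$, and let $J_{F_M}$ be the intersection of $\mathrm{Aut}(F_M)$ with the subgroup $\mathbb C^*\subset(\mathbb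 C^*)^{n+1}$ that defines the weighted projective space. Let $J_{F_A}\subseteq G\subseteq SL(F_A)$ be a subgroup and put $Z_{A,G}=X_A/(G/J_{F_A})$. Let $\rho_i^T=(e^{2\pi i\,b_{ij}/d})_{j}$, where the $i$ in $2\pi i$ is the imaginary unit, and let $$G^T=\Big\{\prod_i(\rho_i^T)^{s_i}\ :\ s\in\mathbb Z^{n+1},\ \prod_i x_i^{s_i}\text{ is }G\text{-invariant}\Big\}.$$ Let $F_{dI}=\sum_i y_i^d$ and $X_{dI}=\{F_{dI}=0\}\subset\mathbb P^n$ (all weights $1$). The Shioda map $(y_k)_k\mapsto(\prod_k y_k^{b_{jk}})_j$ induces $(\phi_B)_*:\mathrm{Aut}(F_{dI})\to\mathrm{Aut}(F_A)$, $(g_k)_k\mapsto(\prod_k g_k^{b_{jk}})_j$. Let $H=((\phi_B)_*)^{-1}(G)\subseteq\mathrm{Aut}(F_{dI})$. Let $pr:\mathbb Z^{n+1}\to\mathrm{Aut}(F_{dI})$, $pr(h)=(e^{2\pi i\,h_j/d})_j$, and $$H^{\perp_B}=pr\big(\{\mathbf s\in\mathbb Z^{n+1}\ :\ \mathbf s^TB\mathbf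 h\in d\mathbb Z\text{ for all }\mathbf h\in pr^{-1}(H)\}\big).$$ Then: 1. $J_{F_{dI}}\subseteq H$, and $Z_{A,G}$ is birational over $\mathbb C$ to $X_{dI}/(H/J_{F_{dI}})$. 2. The $r_j$ are positive and $F_{A^T}$ is quasihomogeneous of degree $d$ for them, so that $X_{A^T}=\{F_{A^T}=0\}\subset W\mathbb P^n(r_0,\dots,r_n)$ is defined; $J_{F_{A^T}}\subseteq G^T\subseteq SL(F_{A^T})$ and $J_{F_{dI}}\subseteq H^{\perp_B}$; and the BHK mirror $Z_{A^T,G^T}=X_{A^T}/(G^T/J_{F_{A^T}})$ is birational over $\mathbb C$ to $X_{dI}/(H^{\perp_B}/J_{F_{dI}})$. -/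

import Mathlib

open MvPolynomial AlgebraicGeometry
open scoped CategoryTheory

noncomputable section

namespace BHK

variable {ι : Type} [Fintype ι]

section Grading

open DirectSum

open Classical in
/-- The quotient of a graded algebra by a homogeneous ideal, graded by the images of the
graded pieces. -/
abbrev quotientGradedAlgebra {k S : Type} [CommRing k] [CommRing S]
    [Algebra k S] (𝒜 : ℕ → Submodule k S)
    [GradedAlgebra 𝒜] (I : Ideal S) (hI : I.IsHomogeneous 𝒜) :
    GradedAlgebra (fun m => (𝒜 m).map (Ideal.Quotient.mkₐ k I).toLinearMap) := by
  let ℬ : ℕ → Submodule k (S ⧸ I) := fun m => (𝒜 m).map (Ideal.Quotient.mkₐ k I).toLinearMap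
  have hmem : ∀ m, ∀ x ∈ 𝒜 m, Ideal.Quotient.mk I x ∈ ℬ m := fun m x hx => ⟨x, hx, rfl⟩
  haveI : SetLike.GradedMonoid ℬ :=
    { one_mem := ⟨1, SetLike.GradedOne.one_mem, map_one (Ideal.Quotient.mk I)⟩
      mul_mem := by
        rintro i j _ _ ⟨x, hx, rfl⟩ ⟨y, hy, rfl⟩
        exact ⟨x * y, SetLike.GradedMul.mul_mem hx hy, map_mul (Ideal.Quotient.mk I) x y⟩ }
  -- the decomposition of representatives
  let ψ : S →ₗ[k] ⨁ i, ℬ i :=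
    (DirectSum.toModule k ℕ (⨁ i, ℬ i) fun i =>
      (DirectSum.lof k ℕ (fun i => ℬ i) i).comp
        ((Ideal.Quotient.mkₐ k I).toLinearMap.restrict (hmem i))).comp
      (DirectSum.decomposeLinearEquiv 𝒜).toLinearMap
  have hψ : ∀ i (x : S) (hx : x ∈ 𝒜 i),
      ψ x = DirectSum.lof k ℕ (fun i => ℬ i) i ⟨Ideal.Quotient.mk I x, hmem i x hx⟩ := by
    intro i x hx
    simp only [ψ, LinearMap.comp_apply, LinearEquiv.coe_coe,
      DirectSum.decomposeLinearEquiv_apply]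
    rw [DirectSum.decompose_of_mem 𝒜 hx, ← DirectSum.lof_eq_of k, DirectSum.toModule_lof]
    rfl
  have hker : ∀ x ∈ I.restrictScalars k, ψ x = 0 := by
    intro x hx
    have hx' : x ∈ I := hx
    rw [← DirectSum.sum_support_decompose 𝒜 x, map_sum]
    refine Finset.sum_eq_zero fun i _ => ?_
    rw [hψ i _ (SetLike.coe_mem _)]
    have h0 : Ideal.Quotient.mk I (DirectSum.decompose 𝒜 x i : S) = 0 :=
      Ideal.Quotient.eq_zero_iff_mem.mpr (hI i hx')
    have : (⟨Ideal.Quotient.mk I (DirectSum.decompose 𝒜 x i : S),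
        hmem i _ (SetLike.coe_mem _)⟩ : ℬ i) = 0 := Subtype.ext h0
    rw [this, map_zero]
  let δ : (S ⧸ I) →ₗ[k] ⨁ i, ℬ i :=
    { QuotientAddGroup.lift I.toAddSubgroup ψ.toAddMonoidHom hker with
      map_smul' := by
        intro c y
        obtain ⟨x, rfl⟩ := Ideal.Quotient.mk_surjective y
        exact ψ.map_smul c x }
  have hδ : ∀ x : S, δ (Ideal.Quotient.mk I x) = ψ x := fun x => rfl
  letI : DirectSum.Decomposition ℬ := by
    refine DirectSum.Decomposition.ofLinearMap ℬ δ ?_ ?_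
    · refine LinearMap.ext fun y => ?_
      obtain ⟨x, rfl⟩ := Ideal.Quotient.mk_surjective y
      rw [LinearMap.comp_apply, hδ]
      conv_rhs => rw [← DirectSum.sum_support_decompose 𝒜 x]
      conv_lhs => rw [← DirectSum.sum_support_decompose 𝒜 x]
      simp only [map_sum]
      refine Finset.sum_congr rfl fun i _ => ?_
      rw [hψ i _ (SetLike.coe_mem _), DirectSum.coeLinearMap_lof]
      rfl
    · refine DirectSum.linearMap_ext _ fun i => LinearMap.ext ?_
      rintro ⟨_, ⟨x, hx, rfl⟩⟩
      simp only [LinearMap.comp_apply, DirectSum.coeLinearMap_lof, LinearMap.id_apply]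
      exact hψ i x hx
  exact { }

open Classical in
/-- A subalgebra that contains the homogeneous components of its elements is graded by its
intersections with the graded pieces. -/
abbrev subalgebraGradedAlgebra {k S : Type} [CommRing k] [CommRing S]
    [Algebra k S] (𝒜 : ℕ → Submodule k S)
    [GradedAlgebra 𝒜] (R : Subalgebra k S)
    (hR : ∀ x ∈ R, ∀ i, (DirectSum.decompose 𝒜 x i : S) ∈ R) :
    GradedAlgebra (fun m => (𝒜 m).comap R.val.toLinearMap) := by
  let ℬ : ℕ → Submodule k R := fun m => (𝒜 m).comap R.val.toLinearMap
  haveI : SetLike.GradedMonoid ℬ :=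
    { one_mem := (SetLike.GradedOne.one_mem : (1 : S) ∈ 𝒜 0)
      mul_mem := fun i j x y hx hy =>
        (SetLike.GradedMul.mul_mem hx hy : (x : S) * (y : S) ∈ 𝒜 (i + j)) }
  have hint : DirectSum.IsInternal ℬ := by
    constructor
    · refine (injective_iff_map_eq_zero _).mpr fun z hz => ?_
      have key : ∀ z : ⨁ i, ℬ i, ∀ i, ((z i : R) : S) =
          DirectSum.decompose 𝒜 ((DirectSum.coeAddMonoidHom ℬ z : R) : S) i := by
        intro z i
        induction z using DirectSum.induction_on with
        | zero => simp
        | of j x =>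
          rw [DirectSum.coeAddMonoidHom_of]
          have hx : ((x : R) : S) ∈ 𝒜 j := x.2
          by_cases h : j = i
          · subst h
            rw [DirectSum.of_eq_same, DirectSum.decompose_of_mem_same 𝒜 hx]
          · rw [DirectSum.of_eq_of_ne _ _ _ (Ne.symm h), DirectSum.decompose_of_mem_ne 𝒜 hx h]
            rfl
        | add x y hx hy =>
          rw [map_add, DirectSum.add_apply]
          push_cast
          rw [DirectSum.decompose_add, DirectSum.add_apply]
          push_cast
          rw [hx, hy]
      refine DFinsupp.ext fun i => Subtype.ext (Subtype.ext ?_)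
      rw [key z i, hz]
      simp
    · intro x
      refine ⟨∑ i ∈ (DirectSum.decompose 𝒜 (x : S)).support,
        DirectSum.of (fun i => ℬ i) i
          ⟨⟨DirectSum.decompose 𝒜 (x : S) i, hR x x.2 i⟩,
            (DirectSum.decompose 𝒜 (x : S) i).2⟩, ?_⟩
      rw [map_sum]
      simp only [DirectSum.coeAddMonoidHom_of]
      refine Subtype.ext ?_
      rw [AddSubmonoidClass.coe_finsetSum]
      exact DirectSum.sum_support_decompose 𝒜 (x : S)
  letI := hint.chooseDecomposition
  exact { }

end Grading

/-! ### The polynomials and their diagonal symmetries -/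

/-- The polynomial `F_A = ∑ i, ∏ j, x_j ^ (a_ij)`. -/
def potential (A : Matrix ι ι ℕ) : MvPolynomial ι ℂ :=
  ∑ i, ∏ j, X j ^ A i j

/-- `F_A` is quasihomogeneous of degree `d` for the weights `q`. -/
def IsWeightSystem (A : Matrix ι ι ℕ) (q : ι → ℕ) (d : ℕ) : Prop :=
  ∀ i, ∑ j, A i j * q j = d

/-- The affine hypersurface `F_A = 0` is singular at the origin and nowhere else. -/
def IsNondegenerate (A : Matrix ι ι ℕ) : Prop :=
  ∀ x : ι → ℂ, (eval x (potential A) = 0 ∧ ∀ j, eval x (pderiv j (potential A)) = 0) ↔ x = 0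

/-- `Aut(F_A)`: the elements of the torus `(ℂˣ)^ι` that leave `F_A` invariant. -/
def diagAut (A : Matrix ι ι ℕ) : Subgroup (ι → ℂˣ) where
  carrier := {g | ∀ x : ι → ℂ,
    eval (fun j => (g j : ℂ) * x j) (potential A) = eval x (potential A)}
  one_mem' := by intro x; simp
  mul_mem' := by
    intro g h hg hh x
    have := hg (fun j => (h j : ℂ) * x j)
    rw [hh x] at this
    simpa [mul_assoc] using this
  inv_mem' := by
    intro g hg x
    have := hg (fun j => ((g⁻¹) j : ℂˣ) * x j)
    simpa using this.symm

/-- `SL(F_A)`: the diagonal symmetries of determinant one. -/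
def diagSL (A : Matrix ι ι ℕ) : Subgroup (ι → ℂˣ) where
  carrier := {g | g ∈ diagAut A ∧ ∏ j, g j = 1}
  one_mem' := ⟨one_mem _, by simp⟩
  mul_mem' := fun hg hh => ⟨mul_mem hg.1 hh.1, by
    simp only [Pi.mul_apply, Finset.prod_mul_distrib, hg.2, hh.2, mul_one]⟩
  inv_mem' := fun hg => ⟨inv_mem hg.1, by
    simp only [Pi.inv_apply, Finset.prod_inv_distrib, hg.2, inv_one]⟩

/-- The one-parameter subgroup `{(t ^ q_j)_j}` by which one divides `ℂ^ι ∖ {0}` to get the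
weighted projective space with weights `q`. -/
def weightTorus (q : ι → ℕ) : Subgroup (ι → ℂˣ) :=
  (MonoidHom.mk' (fun t : ℂˣ => fun j => t ^ q j)
    (fun s t => funext fun j => mul_pow s t (q j))).range

/-- `J_{F_A}`: the intersection of `Aut(F_A)` with the one-parameter subgroup of weights `q`. -/
def expGrp (A : Matrix ι ι ℕ) (q : ι → ℕ) : Subgroup (ι → ℂˣ) :=
  diagAut A ⊓ weightTorus q

/-! ### The hypersurfaces and their quotients -/

/-- The action of an element of the torus on polynomials: `x_j ↦ g_j x_j`. -/
def torusAct (g : ι → ℂˣ) : MvPolynomial ι ℂ →ₐ[ℂ] MvPolynomial ι ℂ :=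
  aeval fun j => C (g j : ℂ) * X j

theorem torusAct_potential (A : Matrix ι ι ℕ) {g : ι → ℂˣ} (hg : g ∈ diagAut A) :
    torusAct g (potential A) = potential A := by
  refine MvPolynomial.funext fun x => ?_
  have h : (aeval x).comp (torusAct g) = aeval (R := ℂ) (fun j => (g j : ℂ) * x j) := by
    ext j
    simp [torusAct]
  have h' := DFunLike.congr_fun h (potential A)
  rw [AlgHom.comp_apply] at h'
  simp only [aeval_eq_eval] at h'
  exact h'.trans (hg x)

theorem torusAct_mem (g : ι → ℂˣ) (q : ι → ℕ) (m : ℕ) {p : MvPolynomial ι ℂ}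
    (hp : p ∈ weightedHomogeneousSubmodule ℂ q m) :
    torusAct g p ∈ weightedHomogeneousSubmodule ℂ q m := by
  rw [mem_weightedHomogeneousSubmodule] at hp ⊢
  rw [p.as_sum, map_sum]
  refine IsWeightedHomogeneous.sum _ _ _ fun s hs => ?_
  have hw : Finsupp.weight q s = m := hp (mem_support_iff.mp hs)
  rw [torusAct, aeval_monomial, Finsupp.prod_fintype _ _ (by simp)]
  simp only [mul_pow, Finset.prod_mul_distrib, ← map_pow, ← map_prod, algebraMap_eq]
  rw [← mul_assoc, ← map_mul]
  refine IsWeightedHomogeneous.C_mul ?_ _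
  have h := IsWeightedHomogeneous.prod (R := ℂ) (w := q) Finset.univ
    (fun j => (X j : MvPolynomial ι ℂ) ^ s j) (fun j => s j * q j)
    (fun j _ => by simpa using (isWeightedHomogeneous_X ℂ q j).pow (s j))
  convert h using 1
  rw [← hw, Finsupp.weight_apply, Finsupp.sum_fintype _ _ (by simp)]
  simp

theorem potential_mem {A : Matrix ι ι ℕ} {q : ι → ℕ} {d : ℕ} (hq : IsWeightSystem A q d) :
    potential A ∈ weightedHomogeneousSubmodule ℂ q d := by
  rw [mem_weightedHomogeneousSubmodule]
  refine IsWeightedHomogeneous.sum _ _ _ fun i _ => ?_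
  rw [← hq i]
  exact IsWeightedHomogeneous.prod _ _ _ fun j _ => by
    simpa using (isWeightedHomogeneous_X ℂ q j).pow (A i j)

/-- The coordinate ring `ℂ[x] / (F_A)`. -/
abbrev CoordRing (A : Matrix ι ι ℕ) : Type :=
  MvPolynomial ι ℂ ⧸ Ideal.span {potential A}

/-- The grading of the coordinate ring in which `x_j` has degree `q_j`. -/
def coordGrading (A : Matrix ι ι ℕ) (q : ι → ℕ) (m : ℕ) : Submodule ℂ (CoordRing A) :=
  (weightedHomogeneousSubmodule ℂ q m).map
    (Ideal.Quotient.mkₐ ℂ (Ideal.span {potential A})).toLinearMap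

abbrev coordGradedAlgebra (A : Matrix ι ι ℕ) (q : ι → ℕ) (d : ℕ) (hq : IsWeightSystem A q d) :
    GradedAlgebra (coordGrading A q) :=
  letI := weightedGradedAlgebra ℂ q
  quotientGradedAlgebra (weightedHomogeneousSubmodule ℂ q) (Ideal.span {potential A})
    (Ideal.homogeneous_span (weightedHomogeneousSubmodule ℂ q) _ fun _ hx =>
      ⟨d, Set.mem_singleton_iff.mp hx ▸ potential_mem hq⟩)

/-- The action of `Aut(F_A)` on the coordinate ring of `F_A = 0`. -/
def coordAct (A : Matrix ι ι ℕ) (g : diagAut A) : CoordRing A →ₐ[ℂ] CoordRing A :=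
  Ideal.quotientMapₐ _ (torusAct g.1) (by
    rw [Ideal.span_le, Set.singleton_subset_iff]
    change torusAct g.1 (potential A) ∈ Ideal.span {potential A}
    rw [torusAct_potential A g.2]
    exact Ideal.subset_span rfl)

theorem coordAct_mem (A : Matrix ι ι ℕ) (q : ι → ℕ) (g : diagAut A) (m : ℕ) {x : CoordRing A}
    (hx : x ∈ coordGrading A q m) : coordAct A g x ∈ coordGrading A q m := by
  obtain ⟨p, hp, rfl⟩ := hx
  exact ⟨torusAct g.1 p, torusAct_mem g.1 q m hp, rfl⟩

/-- The ring of elements of the coordinate ring that are invariant under the elements of `G`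
(a group of diagonal symmetries of `F_A`). -/
def invariants (A : Matrix ι ι ℕ) (G : Subgroup (ι → ℂˣ)) : Subalgebra ℂ (CoordRing A) where
  carrier := {x | ∀ g : diagAut A, g.1 ∈ G → coordAct A g x = x}
  mul_mem' := fun hx hy g hg => by rw [map_mul, hx g hg, hy g hg]
  add_mem' := fun hx hy g hg => by rw [map_add, hx g hg, hy g hg]
  algebraMap_mem' := fun r g _ => (coordAct A g).commutes r

/-- The grading of the ring of invariants. -/
def invGrading (A : Matrix ι ι ℕ) (q : ι → ℕ) (G : Subgroup (ι → ℂˣ)) (m : ℕ) :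
    Submodule ℂ (invariants A G) :=
  (coordGrading A q m).comap (invariants A G).val.toLinearMap

abbrev invGradedAlgebra (A : Matrix ι ι ℕ) (q : ι → ℕ) (d : ℕ) (hq : IsWeightSystem A q d)
    (G : Subgroup (ι → ℂˣ)) : GradedAlgebra (invGrading A q G) :=
  letI := coordGradedAlgebra A q d hq
  subalgebraGradedAlgebra (coordGrading A q) (invariants A G) (by
    intro x hx i g hg
    have key : ∀ y : CoordRing A,
        (DirectSum.decompose (coordGrading A q) (coordAct A g y) i : CoordRing A) =
          coordAct A g (DirectSum.decompose (coordGrading A q) y i) := by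
      intro y
      induction y using DirectSum.Decomposition.inductionOn (coordGrading A q) with
      | zero => rw [map_zero (coordAct A g), DirectSum.decompose_zero, DirectSum.zero_apply, Submodule.coe_zero, map_zero (coordAct A g)]
      | @homogeneous j y =>
        have hy := coordAct_mem A q g j y.2
        by_cases h : j = i
        · subst h
          rw [DirectSum.decompose_of_mem_same _ hy, DirectSum.decompose_of_mem_same _ y.2]
        · rw [DirectSum.decompose_of_mem_ne _ hy h, DirectSum.decompose_of_mem_ne _ y.2 h,
            map_zero (coordAct A g)]
      | add y z hy hz =>
        rw [map_add (coordAct A g), DirectSum.decompose_add, DirectSum.decompose_add,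
          DirectSum.add_apply, DirectSum.add_apply, Submodule.coe_add, Submodule.coe_add,
          map_add (coordAct A g), hy, hz]
    rw [← key, hx g hg])

/-- The quotient of the hypersurface `X_A = {F_A = 0}` of the weighted projective space with
weights `q` (that is, of `Proj` of the coordinate ring `S` graded by `coordGrading A q`) by a finite
group `G ≤ Aut(F_A)`: the quotient of `Proj S` by a finite group that acts by graded automorphisms
of `S` is `Proj` of the graded ring of invariants. The elements of `J_{F_A}` act trivially on `X_A`,
so for `J_{F_A} ≤ G` this is the quotient `X_A / (G / J_{F_A})`. -/
def orbifold (A : Matrix ι ι ℕ) (q : ι → ℕ) (d : ℕ) (hq : IsWeightSystem A q d)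
    (G : Subgroup (ι → ℂˣ)) : Scheme :=
  letI := invGradedAlgebra A q d hq G
  Proj (invGrading A q G)

/-- The structure morphism of the quotient to `Spec ℂ`. -/
def orbifoldToSpec (A : Matrix ι ι ℕ) (q : ι → ℕ) (d : ℕ) (hq : IsWeightSystem A q d)
    (G : Subgroup (ι → ℂˣ)) : orbifold A q d hq G ⟶ Spec (CommRingCat.of ℂ) :=
  letI := invGradedAlgebra A q d hq G
  Proj.toSpecZero (invGrading A q G) ≫
    Spec.map (CommRingCat.ofHom (algebraMap ℂ (invGrading A q G 0)))

/-! ### Shioda maps, the dual group and the orthogonal complement -/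

/-- The homomorphism `(φ_B)_*` induced on the torus by the Shioda map
`φ_B : (y_k)_k ↦ (∏ k, y_k ^ (b_jk))_j`. On an element `(exp (2πi h_k / d))_k` it takes the value
`(exp (2πi (∑ k, b_jk h_k) / d))_j`. -/
def shiodaPush (B : Matrix ι ι ℤ) : (ι → ℂˣ) →* (ι → ℂˣ) where
  toFun g := fun j => ∏ k, g k ^ B j k
  map_one' := by ext j; simp
  map_mul' g h := by ext j; simp [mul_zpow, Finset.prod_mul_distrib]

/-- `pr : ℤ^ι → (ℂˣ)^ι`, `h ↦ (exp (2πi h_j / d))_j`. -/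
def pr {κ : Type} (d : ℕ) (h : κ → ℤ) : κ → ℂˣ := fun j =>
  Units.mk0 (Complex.exp (2 * Real.pi * Complex.I * h j / d)) (Complex.exp_ne_zero _)

theorem pr_zero {κ : Type} (d : ℕ) : pr d (0 : κ → ℤ) = 1 := by
  ext j; simp [pr]

theorem pr_add {κ : Type} (d : ℕ) (s t : κ → ℤ) : pr d (s + t) = pr d s * pr d t := by
  ext j
  simp only [pr, Pi.add_apply, Pi.mul_apply, Units.val_mk0, Units.val_mul, ← Complex.exp_add]
  congr 1
  push_cast
  ring

theorem pr_neg {κ : Type} (d : ℕ) (s : κ → ℤ) : pr d (-s) = (pr d s)⁻¹ := by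
  rw [eq_inv_iff_mul_eq_one, ← pr_add, neg_add_cancel, pr_zero]

/-- The exponent matrix `d I` of the Fermat polynomial `F_{dI} = ∑ i, y_i ^ d`. -/
def fermat [DecidableEq ι] (d : ℕ) : Matrix ι ι ℕ := d • (1 : Matrix ι ι ℕ)

theorem isWeightSystem_fermat [DecidableEq ι] (d : ℕ) :
    IsWeightSystem (fermat d : Matrix ι ι ℕ) 1 d := by
  intro i
  simp [fermat, Matrix.one_apply]

/-- `H = ((φ_B)_*)⁻¹(G)`, a subgroup of `Aut(F_{dI})`. -/
def shiodaPreimage [DecidableEq ι] (d : ℕ) (B : Matrix ι ι ℤ) (G : Subgroup (ι → ℂˣ)) :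
    Subgroup (ι → ℂˣ) :=
  diagAut (fermat d) ⊓ G.comap (shiodaPush B)

/-- `H^{⊥_B}`: the image under `pr` of the set of those `s` in `ℤ^ι` for which `sᵀ B h` is
divisible by `d` for every `h` in `pr⁻¹(H)`. -/
def orthCompl (d : ℕ) (B : Matrix ι ι ℤ) (H : Subgroup (ι → ℂˣ)) : Subgroup (ι → ℂˣ) where
  carrier := {g | ∃ s : ι → ℤ,
    (∀ h : ι → ℤ, pr d h ∈ H → (d : ℤ) ∣ s ⬝ᵥ B.mulVec h) ∧ pr d s = g}
  one_mem' := ⟨0, fun h _ => by simp, pr_zero d⟩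
  mul_mem' := by
    rintro _ _ ⟨s, hs, rfl⟩ ⟨t, ht, rfl⟩
    exact ⟨s + t, fun h hh => by rw [add_dotProduct]; exact dvd_add (hs h hh) (ht h hh),
      pr_add d s t⟩
  inv_mem' := by
    rintro _ ⟨s, hs, rfl⟩
    exact ⟨-s, fun h hh => by rw [neg_dotProduct]; exact (hs h hh).neg_right, pr_neg d s⟩

/-- `G^T`: the elements `∏ i, (ρ_i^T) ^ (s_i)` for those `s` for which the monomial
`∏ i, x_i ^ (s_i)` is `G`-invariant. Here `ρ_i^T = (exp (2πi b_ij / d))_j`. -/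
def dualGroup (d : ℕ) (B : Matrix ι ι ℤ) (G : Subgroup (ι → ℂˣ)) : Subgroup (ι → ℂˣ) where
  carrier := {g | ∃ s : ι → ℤ,
    (∀ l ∈ G, ∀ x : ι → ℂˣ, ∏ i, (l i * x i) ^ s i = ∏ i, x i ^ s i) ∧
      ∏ i, pr d (B i) ^ s i = g}
  one_mem' := ⟨0, by simp, by simp⟩
  mul_mem' := by
    rintro _ _ ⟨s, hs, rfl⟩ ⟨t, ht, rfl⟩
    exact ⟨s + t, fun l hl x => by
      simp only [Pi.add_apply, zpow_add, Finset.prod_mul_distrib, hs l hl x, ht l hl x],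
      by simp only [Pi.add_apply, zpow_add, Finset.prod_mul_distrib]⟩
  inv_mem' := by
    rintro _ ⟨s, hs, rfl⟩
    exact ⟨-s, fun l hl x => by
      simp only [Pi.neg_apply, zpow_neg, Finset.prod_inv_distrib, hs l hl x],
      by simp only [Pi.neg_apply, zpow_neg, Finset.prod_inv_distrib]⟩

end BHK

end

/-! The Shioda map pulls the monomial with exponent `m` back to the monomial with exponent `mB`, and
it pulls `F_A` back to the Fermat polynomial because `AB = dI`. Everything is therefore compared
inside one ring, the Laurent polynomials modulo the Fermat polynomial (`FermatTorus`). Inverting the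
invariant `(∏ x_j)^d` cuts the quotient of the hypersurface down to a dense affine open set. The
coordinate ring of that set, embedded in `FermatTorus`, is the span of the invariant Laurent
monomials of weight zero (`awayRange_invGrading`). Birationality becomes an equality of two sets of
exponents (`birationalOver_orbifold`).

That equality is `image_zeroExponents`. Weights match because `B` applied to the all-ones vector is
`q`, so weight zero in `x` is total degree zero in `y`. Invariance matches because the map on
diagonal symmetries is onto `Aut(F_A)`, while the columns of `A` give elements of its kernel. These
lie in `H`, so an `H`-invariant exponent `m'` has `m'A` divisible by `d` and is `mB` for `m =
m'A/d`.

The embedding needs `F_A` to be coprime to every variable (`potential_dvd_of_laurentMap_mem`), that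
is, a zero in every column of `A`; for the mirror, a zero in every row. Both zeros and the
positivity of the `r_j` come from the shape of `A`. Nondegeneracy and the Calabi–Yau condition make
each monomial a power of its own variable, of exponent at least two, times at most one other
variable, and no variable is attached to two powers (`exists_isInvertibleType`,
`IsInvertibleType.unique`).

The mirror statement is the first statement for the transposed data, since `H^{⊥_B}` is exactly the
preimage of `G^T` under the Shioda map of `Bᵀ` (`orthCompl_shiodaPreimage`). -/

namespace BHK

/-! ### Birational geometry of `Proj`: reduction to degree zero localizations -/

section Proj

open HomogeneousLocalization CategoryTheory

variable {k R R' L : Type} [CommRing k] [CommRing R] [Algebra k R] [CommRing R'] [Algebra k R']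
  [CommRing L]

/-- The structure morphism of `Proj` of a graded `k`-algebra. -/
noncomputable abbrev projToSpec (𝒜 : ℕ → Submodule k R) [GradedAlgebra 𝒜] :
    Proj 𝒜 ⟶ Spec (CommRingCat.of k) :=
  Proj.toSpecZero 𝒜 ≫ Spec.map (CommRingCat.ofHom (algebraMap k (𝒜 0)))

/-- Every point of a basic open set of `Proj` has a neighbourhood inside it that is the basic open
set of a homogeneous element of positive degree. -/
theorem exists_homogeneous_basicOpen (𝒜 : ℕ → Submodule k R) [GradedAlgebra 𝒜] (g : R)
    {x : Proj 𝒜} (hx : x ∈ Proj.basicOpen 𝒜 g) :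
    ∃ (e : ℕ) (h : R), 0 < e ∧ h ∈ 𝒜 e ∧ x ∈ Proj.basicOpen 𝒜 h ∧
      Proj.basicOpen 𝒜 h ≤ Proj.basicOpen 𝒜 g := by
  classical
  rw [Proj.basicOpen_eq_iSup_proj, TopologicalSpace.Opens.mem_iSup] at hx
  obtain ⟨i, hi⟩ := hx
  -- The component of `g` may have degree zero. Multiplying it by a component of an irrelevant
  -- element that does not vanish at `x` makes the degree positive.
  obtain ⟨a, ha, hax⟩ := SetLike.not_le_iff_exists.mp x.not_irrelevant_le
  have hax' : x ∈ Proj.basicOpen 𝒜 a := hax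
  rw [Proj.basicOpen_eq_iSup_proj, TopologicalSpace.Opens.mem_iSup] at hax'
  obtain ⟨j, hj⟩ := hax'
  have hj0 : 0 < j := by
    rcases Nat.eq_zero_or_pos j with rfl | h
    · rw [(HomogeneousIdeal.mem_irrelevant_iff _ _).mp ha, Proj.basicOpen_zero] at hj
      exact absurd hj (by simp)
    · exact h
  refine ⟨i + j, GradedRing.proj 𝒜 i g * GradedRing.proj 𝒜 j a, by omega,
    SetLike.mul_mem_graded (SetLike.coe_mem _) (SetLike.coe_mem _), ?_, ?_⟩
  · rw [Proj.basicOpen_mul]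
    exact ⟨hi, hj⟩
  · rw [Proj.basicOpen_mul, Proj.basicOpen_eq_iSup_proj 𝒜 g]
    exact inf_le_left.trans (le_iSup (fun i => Proj.basicOpen 𝒜 (GradedRing.proj 𝒜 i g)) i)

/-- The basic open set of a homogeneous non-zero-divisor of positive degree is dense in `Proj`. -/
theorem dense_basicOpen (𝒜 : ℕ → Submodule k R) [GradedAlgebra 𝒜] {f : R} {m : ℕ}
    (hfm : f ∈ 𝒜 m) (hm : 0 < m) (hf : f ∈ nonZeroDivisors R) :
    Dense (Proj.basicOpen 𝒜 f : Set (Proj 𝒜)) := by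
  intro x
  rw [mem_closure_iff]
  intro U hU hx
  obtain ⟨_, ⟨g, rfl⟩, hxg, hgU⟩ :=
    TopologicalSpace.Opens.isBasis_iff_nbhd.mp (Proj.isBasis_basicOpen 𝒜)
      (U := ⟨U, hU⟩) (x := x) hx
  obtain ⟨e, h, he, hhe, hxh, hhg⟩ := exists_homogeneous_basicOpen 𝒜 g hxg
  -- Inside the affine chart of `h`, the basic open set of `f` is where `f ^ e / h ^ m` does not
  -- vanish. If this fraction were nilpotent, cancelling the non-zero-divisor `f` would make `h`
  -- nilpotent, although `h` does not vanish at `x`.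
  have hs : ¬ IsNilpotent (Away.isLocalizationElem hhe hfm) := by
    rintro ⟨N, hN⟩
    have hval := congrArg HomogeneousLocalization.val hN
    rw [HomogeneousLocalization.val_pow, Away.val_mk, HomogeneousLocalization.val_zero,
      Localization.mk_pow, Localization.mk_eq_mk', IsLocalization.mk'_eq_zero_iff] at hval
    obtain ⟨⟨_, c, rfl⟩, hc⟩ := hval
    rw [← pow_mul] at hc
    have h0 : h ^ c = 0 := (mem_nonZeroDivisors_iff.mp (pow_mem hf (e * N))).2 _ hc
    refine hxh (x.isPrime.mem_of_pow_mem c ?_)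
    rw [h0]
    exact zero_mem _
  rw [← mem_nilradical, nilradical_eq_sInf, Ideal.mem_sInf] at hs
  push Not at hs
  obtain ⟨p, hp, hsp⟩ := hs
  let y : Spec (CommRingCat.of (Away 𝒜 h)) := ⟨p, hp⟩
  have hy : y ∈ Proj.awayι 𝒜 h hhe he ⁻¹ᵁ Proj.basicOpen 𝒜 f := by
    rw [Proj.awayι_preimage_basicOpen 𝒜 hhe he hfm hm]
    exact hsp
  refine ⟨Proj.awayι 𝒜 h hhe he y, hgU (hhg ?_), hy⟩
  rw [← Proj.opensRange_awayι 𝒜 h hhe he]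
  exact ⟨y, rfl⟩

/-- `Proj` of a graded algebra is birational to the spectrum of the degree zero part of its
localization at a homogeneous non-zero-divisor of positive degree. -/
theorem birationalOver_away (𝒜 : ℕ → Submodule k R) [GradedAlgebra 𝒜] {f : R} {m : ℕ}
    (hfm : f ∈ 𝒜 m) (hm : 0 < m) (hf : f ∈ nonZeroDivisors R) :
    Scheme.BirationalOver
      (Spec.map (CommRingCat.ofHom ((fromZeroRingHom 𝒜 (Submonoid.powers f)).comp
        (algebraMap k (𝒜 0))))) (projToSpec 𝒜) := by
  have : IsDominant (Proj.awayι 𝒜 f hfm hm) := ⟨by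
    have h := dense_basicOpen 𝒜 hfm hm hf
    rw [← Proj.opensRange_awayι 𝒜 f hfm hm] at h
    exact h⟩
  refine Scheme.Hom.birationalOver (Proj.awayι 𝒜 f hfm hm) _ _ ?_
  rw [projToSpec, Proj.awayι_toSpecZero_assoc, ← Spec.map_comp, ← CommRingCat.ofHom_comp]

/-- The ring homomorphism that a homomorphism which inverts `f` induces on the degree zero part
of the localization at `f`. -/
noncomputable def awayLift (𝒜 : ℕ → Submodule k R) [GradedAlgebra 𝒜] {f : R} (ψ : R →+* L)
    (hu : IsUnit (ψ f)) : Away 𝒜 f →+* L :=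
  (IsLocalization.Away.lift (S := Localization.Away f) f hu).comp
    (algebraMap (Away 𝒜 f) (Localization.Away f))

theorem awayLift_mk_mul (𝒜 : ℕ → Submodule k R) [GradedAlgebra 𝒜] {f : R} {m : ℕ}
    (hfm : f ∈ 𝒜 m) (ψ : R →+* L) (hu : IsUnit (ψ f)) (n : ℕ) (a : R) (ha : a ∈ 𝒜 (n • m)) :
    awayLift 𝒜 ψ hu (Away.mk 𝒜 hfm n a ha) * ψ f ^ n = ψ a := by
  have h1 : ψ f ^ n = IsLocalization.Away.lift (S := Localization.Away f) f hu
        (algebraMap R _ (f ^ n)) := by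
    rw [IsLocalization.Away.lift_eq, map_pow]
  rw [awayLift, RingHom.comp_apply, HomogeneousLocalization.algebraMap_apply, Away.val_mk, h1,
    ← map_mul, Localization.mk_eq_mk', IsLocalization.mk'_spec _ a (⟨f ^ n, n, rfl⟩ : Submonoid.powers f),
    IsLocalization.Away.lift_eq]

theorem awayLift_comp_fromZeroRingHom (𝒜 : ℕ → Submodule k R) [GradedAlgebra 𝒜] {f : R}
    (ψ : R →+* L) (hu : IsUnit (ψ f)) (c : 𝒜 0) :
    awayLift 𝒜 ψ hu (fromZeroRingHom 𝒜 (Submonoid.powers f) c) = ψ c := by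
  rw [awayLift, RingHom.comp_apply, HomogeneousLocalization.algebraMap_apply, fromZeroRingHom]
  change IsLocalization.Away.lift (S := Localization.Away f) f hu (Localization.mk (c : R) 1) = _
  rw [Localization.mk_one_eq_algebraMap, IsLocalization.Away.lift_eq]

/-- A fraction `a / f ^ n` goes to `ψ a / ψ f ^ n`, which vanishes only if `ψ a = 0`, hence `a = 0`.
-/
theorem awayLift_injective (𝒜 : ℕ → Submodule k R) [GradedAlgebra 𝒜] {f : R} {m : ℕ}
    (hfm : f ∈ 𝒜 m) (ψ : R →+* L) (hu : IsUnit (ψ f)) (hψ : Function.Injective ψ) :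
    Function.Injective (awayLift 𝒜 ψ hu) := by
  rw [injective_iff_map_eq_zero]
  intro z hz
  obtain ⟨n, a, ha, rfl⟩ := Away.mk_surjective 𝒜 hfm z
  have h := awayLift_mk_mul 𝒜 hfm ψ hu n a ha
  rw [hz, zero_mul, eq_comm, map_eq_zero_iff ψ hψ] at h
  subst h
  ext
  rw [Away.val_mk, Localization.mk_zero, HomogeneousLocalization.val_zero]

/-- The elements `ψ a / ψ f ^ n` of `L`, where `a` is homogeneous of degree `n • m`. -/
def awayRange (𝒜 : ℕ → Submodule k R) (f : R) (m : ℕ) (ψ : R →+* L) : Set L :=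
  {l | ∃ n, ∃ a ∈ 𝒜 (n • m), l * ψ f ^ n = ψ a}

/-- Fractions with denominators `f ^ n` and `f ^ n'` can be added over `f ^ (n + n')`, so these
fractions form a subspace and only spanning elements have to be checked. -/
theorem span_subset_awayRange [Algebra k L] (𝒜 : ℕ → Submodule k R) [GradedAlgebra 𝒜] {f : R}
    {m : ℕ} (hfm : f ∈ 𝒜 m) (ψ : R →ₐ[k] L) {T : Set L} (hT : T ⊆ awayRange 𝒜 f m (ψ : R →+* L)) :
    (Submodule.span k T : Set L) ⊆ awayRange 𝒜 f m (ψ : R →+* L) := by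
  intro l hl
  induction hl using Submodule.span_induction with
  | mem l hl => exact hT hl
  | zero => exact ⟨0, 0, zero_mem _, by simp⟩
  | add x y _ _ hx hy =>
    obtain ⟨n, a, ha, h⟩ := hx
    obtain ⟨n', a', ha', h'⟩ := hy
    refine ⟨n + n', a * f ^ n' + a' * f ^ n, add_mem ?_ ?_, ?_⟩
    · rw [add_smul]
      exact SetLike.mul_mem_graded ha (SetLike.pow_mem_graded n' hfm)
    · rw [add_comm, add_smul]
      exact SetLike.mul_mem_graded ha' (SetLike.pow_mem_graded n hfm)
    · rw [map_add, map_mul, map_mul, ← h, ← h', map_pow, map_pow]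
      ring
  | smul c x _ hx =>
    obtain ⟨n, a, ha, h⟩ := hx
    refine ⟨n, c • a, Submodule.smul_mem _ _ ha, ?_⟩
    rw [smul_mul_assoc, h]
    exact (map_smul ψ c a).symm

theorem range_awayLift (𝒜 : ℕ → Submodule k R) [GradedAlgebra 𝒜] {f : R} {m : ℕ}
    (hfm : f ∈ 𝒜 m) (ψ : R →+* L) (hu : IsUnit (ψ f)) :
    Set.range (awayLift 𝒜 ψ hu) = awayRange 𝒜 f m ψ := by
  ext l
  constructor
  · rintro ⟨z, rfl⟩
    obtain ⟨n, a, ha, rfl⟩ := Away.mk_surjective 𝒜 hfm z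
    exact ⟨n, a, ha, awayLift_mk_mul 𝒜 hfm ψ hu n a ha⟩
  · rintro ⟨n, a, ha, h⟩
    exact ⟨Away.mk 𝒜 hfm n a ha, (hu.pow n).mul_right_cancel
      ((awayLift_mk_mul 𝒜 hfm ψ hu n a ha).trans h.symm)⟩

/-- Two injective ring homomorphisms with the same range differ by an isomorphism. -/
theorem exists_ringEquiv_of_range_eq {S T L : Type} [CommRing S] [CommRing T] [CommRing L]
    (φ : S →+* L) (θ : T →+* L) (hφ : Function.Injective φ) (hθ : Function.Injective θ)
    (h : Set.range φ = Set.range θ) : ∃ e : S ≃+* T, ∀ x, θ (e x) = φ x := by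
  have h' : φ.range = θ.range := SetLike.coe_injective (by simpa using h)
  have hb : Function.Bijective φ.rangeRestrict :=
    ⟨fun x y hxy => hφ (congrArg Subtype.val hxy), φ.rangeRestrict_surjective⟩
  have hb' : Function.Bijective θ.rangeRestrict :=
    ⟨fun x y hxy => hθ (congrArg Subtype.val hxy), θ.rangeRestrict_surjective⟩
  refine ⟨(RingEquiv.ofBijective _ hb).trans
    ((RingEquiv.subringCongr h').trans (RingEquiv.ofBijective _ hb').symm), fun x => ?_⟩
  have key := (RingEquiv.ofBijective _ hb').apply_symm_apply
    (RingEquiv.subringCongr h' (RingEquiv.ofBijective _ hb x))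
  exact congrArg Subtype.val key

/-- Two graded algebras whose degree zero localizations have the same image in a common algebra
have birational `Proj`s. -/
theorem birationalOver_of_awayRange_eq [Algebra k L] (𝒜 : ℕ → Submodule k R) [GradedAlgebra 𝒜]
    (ℬ : ℕ → Submodule k R') [GradedAlgebra ℬ] {f : R} {g : R'} {m n : ℕ}
    (hf : f ∈ 𝒜 m) (hg : g ∈ ℬ n) (hm : 0 < m) (hn : 0 < n)
    (ψ : R →ₐ[k] L) (χ : R' →ₐ[k] L) (hψ : Function.Injective ψ) (hχ : Function.Injective χ)
    (hψf : IsUnit (ψ f)) (hχg : IsUnit (χ g))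
    (h : awayRange 𝒜 f m (ψ : R →+* L) = awayRange ℬ g n (χ : R' →+* L)) :
    Scheme.BirationalOver (projToSpec 𝒜) (projToSpec ℬ) := by
  have hfz : f ∈ nonZeroDivisors R := mem_nonZeroDivisors_of_injective hψ hψf.mem_nonZeroDivisors
  have hgz : g ∈ nonZeroDivisors R' := mem_nonZeroDivisors_of_injective hχ hχg.mem_nonZeroDivisors
  have hψf' : IsUnit ((ψ : R →+* L) f) := hψf
  have hχg' : IsUnit ((χ : R' →+* L) g) := hχg
  obtain ⟨e, he⟩ := exists_ringEquiv_of_range_eq (awayLift 𝒜 (ψ : R →+* L) hψf')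
    (awayLift ℬ (χ : R' →+* L) hχg') (awayLift_injective 𝒜 hf _ _ hψ)
    (awayLift_injective ℬ hg _ _ hχ) (by rw [range_awayLift 𝒜 hf, range_awayLift ℬ hg, h])
  refine ((birationalOver_away 𝒜 hf hm hfz).symm.trans ?_).trans (birationalOver_away ℬ hg hn hgz)
  let E : CommRingCat.of (Away 𝒜 f) ≅ CommRingCat.of (Away ℬ g) := e.toCommRingCatIso
  refine (Scheme.Hom.birationalOver (Spec.map E.hom) _ _ ?_).symm
  rw [← Spec.map_comp]
  congr 1
  refine CommRingCat.hom_ext (RingHom.ext fun c => ?_)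
  -- Compatibility with the structure maps is tested in `L`, where both sides become the image of
  -- the scalar.
  refine awayLift_injective ℬ hg (χ : R' →+* L) hχg' hχ ?_
  change awayLift ℬ (χ : R' →+* L) hχg' (e (fromZeroRingHom 𝒜 (Submonoid.powers f)
    (algebraMap k (𝒜 0) c))) = awayLift ℬ (χ : R' →+* L) hχg'
      (fromZeroRingHom ℬ (Submonoid.powers g) (algebraMap k (ℬ 0) c))
  rw [he, awayLift_comp_fromZeroRingHom, awayLift_comp_fromZeroRingHom]
  exact (ψ.commutes c).trans (χ.commutes c).symm

end Proj

/-! ### Laurent polynomials and the injectivity of the monomial substitution -/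

section Laurent

variable {ι : Type}

/-- The algebra of Laurent polynomials in variables indexed by `ι`. -/
abbrev Laurent (ι : Type) : Type := AddMonoidAlgebra ℂ (ι → ℤ)

/-- The Laurent monomial with exponent `m`. -/
noncomputable abbrev lmon (m : ι → ℤ) : Laurent ι := AddMonoidAlgebra.single m 1

theorem lmon_mul_lmon (m m' : ι → ℤ) : lmon m * lmon m' = lmon (m + m') := by
  simp [lmon, AddMonoidAlgebra.single_mul_single]

theorem lmon_zero : lmon (0 : ι → ℤ) = 1 := rfl

theorem lmon_pow (m : ι → ℤ) (n : ℕ) : lmon m ^ n = lmon (n • m) := by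
  simp [lmon, AddMonoidAlgebra.single_pow]

theorem isUnit_lmon (m : ι → ℤ) : IsUnit (lmon m) :=
  IsUnit.of_mul_eq_one (lmon (-m)) (by rw [lmon_mul_lmon, add_neg_cancel, lmon_zero])

theorem lmon_sum {κ : Type} (s : Finset κ) (m : κ → ι → ℤ) :
    ∏ i ∈ s, lmon (m i) = lmon (∑ i ∈ s, m i) := by
  classical
  induction s using Finset.induction_on with
  | empty => simp [lmon_zero]
  | insert a s ha ih => rw [Finset.prod_insert ha, ih, lmon_mul_lmon, Finset.sum_insert ha]

variable [Fintype ι]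

/-- The monomial substitution `x_j ↦ ∏ k, y_k ^ (b_jk)`. -/
noncomputable def laurentMap (B : Matrix ι ι ℤ) : MvPolynomial ι ℂ →ₐ[ℂ] Laurent ι :=
  aeval fun j => lmon (B j)

theorem laurentMap_monomial (B : Matrix ι ι ℤ) (s : ι →₀ ℕ) (c : ℂ) :
    laurentMap B (monomial s c) =
      AddMonoidAlgebra.single (Matrix.vecMul (fun j => (s j : ℤ)) B) c := by
  rw [laurentMap, aeval_monomial, Finsupp.prod_fintype _ _ (by simp)]
  simp only [lmon_pow, lmon_sum]
  have hc : algebraMap ℂ (Laurent ι) c = AddMonoidAlgebra.single 0 c := rfl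
  rw [hc, AddMonoidAlgebra.single_mul_single, zero_add, mul_one, Matrix.vecMul_eq_sum]
  simp

theorem laurentMap_potential_eq_sum (A : Matrix ι ι ℕ) (B : Matrix ι ι ℤ) :
    laurentMap B (potential A) = ∑ i, lmon (Matrix.vecMul (fun j => (A i j : ℤ)) B) := by
  rw [potential, map_sum]
  refine Finset.sum_congr rfl fun i _ => ?_
  rw [map_prod]
  simp only [map_pow, laurentMap, aeval_X, lmon_pow, lmon_sum]
  rw [Matrix.vecMul_eq_sum]
  simp

/-- Here `comapDomain` discards all terms with exponents outside the sublattice of the vectors `mB`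
and renames `mB` to `m`. A shift by a vector of the sublattice preserves both the sublattice and its
complement, so this projection is linear over the monomials of the sublattice. -/
theorem comapDomain_lmon_mul (B : Matrix ι ι ℤ)
    (hB : Function.Injective fun m => Matrix.vecMul m B) (a : ι → ℤ) (v : Laurent ι) :
    AddMonoidAlgebra.comapDomain _ hB (lmon (Matrix.vecMul a B) * v) =
      lmon a * AddMonoidAlgebra.comapDomain _ hB v := by
  ext m
  rw [AddMonoidAlgebra.coeff_comapDomain, Finsupp.comapDomain_apply,
    AddMonoidAlgebra.coeff_single_mul_apply, AddMonoidAlgebra.coeff_single_mul_apply,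
    AddMonoidAlgebra.coeff_comapDomain, Finsupp.comapDomain_apply, Matrix.add_vecMul,
    Matrix.neg_vecMul]

variable [DecidableEq ι]

/-- For the identity matrix the substitution only reads natural exponents as integers. -/
theorem laurentMap_one_injective : Function.Injective (laurentMap (1 : Matrix ι ι ℤ)) := by
  have h : ∀ p : MvPolynomial ι ℂ, laurentMap (1 : Matrix ι ι ℤ) p =
      AddMonoidAlgebra.mapDomain (fun (s : ι →₀ ℕ) (j : ι) => (s j : ℤ)) p := by
    intro p
    induction p using MvPolynomial.induction_on' with
    | monomial s c =>
      rw [laurentMap_monomial, Matrix.vecMul_one]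
      rw [← single_eq_monomial, AddMonoidAlgebra.mapDomain_single]
    | add p q hp hq =>
      rw [map_add, hp, hq]
      exact (AddMonoidAlgebra.mapDomain_add _ _ _).symm
  intro p q hpq
  rw [h, h] at hpq
  refine AddMonoidAlgebra.mapDomain_injective ?_ hpq
  intro s t hst
  ext j
  exact Int.ofNat_inj.mp (congrFun hst j)

/-- Every Laurent polynomial is the quotient of a polynomial by a monomial. -/
theorem exists_lmon_mul_eq (w : Laurent ι) : ∃ (N : ℕ) (p : MvPolynomial ι ℂ),
    lmon (fun _ => (N : ℤ)) * w = laurentMap 1 p := by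
  induction w using AddMonoidAlgebra.induction_linear with
  | zero => exact ⟨0, 0, by simp⟩
  | add v w hv hw =>
    obtain ⟨N, p, hp⟩ := hv
    obtain ⟨M, q, hq⟩ := hw
    have hmon : ∀ K : ℕ, lmon (fun _ => (K : ℤ)) =
        laurentMap (1 : Matrix ι ι ℤ) (monomial (Finsupp.equivFunOnFinite.symm fun _ => K) 1) := by
      intro K
      rw [laurentMap_monomial, Matrix.vecMul_one]
      rfl
    refine ⟨N + M, monomial (Finsupp.equivFunOnFinite.symm fun _ => M) 1 * p +
      monomial (Finsupp.equivFunOnFinite.symm fun _ => N) 1 * q, ?_⟩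
    have h1 : lmon (fun _ : ι => ((N + M : ℕ) : ℤ)) =
        lmon (fun _ => (N : ℤ)) * lmon (fun _ => (M : ℤ)) := by
      rw [lmon_mul_lmon]
      congr 1
    rw [map_add, map_mul, map_mul, ← hp, ← hq, ← hmon, ← hmon, h1]
    ring
  | single m c =>
    -- The sum of the `|m j|` bounds each of them, so adding it makes all exponents nonnegative.
    refine ⟨∑ j, (m j).natAbs, monomial (Finsupp.equivFunOnFinite.symm fun j =>
      (((∑ j, (m j).natAbs : ℕ) : ℤ) + m j).toNat) c, ?_⟩
    rw [laurentMap_monomial, Matrix.vecMul_one, AddMonoidAlgebra.single_mul_single, one_mul]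
    congr 1
    funext j
    have h : (m j).natAbs ≤ ∑ j, (m j).natAbs :=
      Finset.single_le_sum (f := fun j => (m j).natAbs) (fun _ _ => Nat.zero_le _)
        (Finset.mem_univ j)
    simp only [Pi.add_apply, Finsupp.equivFunOnFinite_symm_apply_apply]
    rw [Int.toNat_of_nonneg (by omega)]

/-- The Fermat polynomial as a Laurent polynomial. -/
noncomputable def fermatLaurent (ι : Type) [Fintype ι] [DecidableEq ι] (d : ℕ) : Laurent ι :=
  ∑ i, lmon ((d : ℤ) • Pi.single i 1)

theorem vecMul_row_of_mul_eq {A : Matrix ι ι ℕ} {B : Matrix ι ι ℤ} {d : ℕ}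
    (hAB : A.map (Nat.cast : ℕ → ℤ) * B = (d : ℤ) • 1) (i : ι) :
    Matrix.vecMul (fun j => (A i j : ℤ)) B = (d : ℤ) • Pi.single i 1 := by
  have h := congrFun hAB i
  ext k
  have h' := congrFun h k
  simpa [Matrix.mul_apply, Matrix.vecMul, dotProduct, Matrix.one_apply, Pi.single_apply,
    eq_comm] using h'

theorem laurentMap_potential {A : Matrix ι ι ℕ} {B : Matrix ι ι ℤ} {d : ℕ}
    (hAB : A.map (Nat.cast : ℕ → ℤ) * B = (d : ℤ) • 1) :
    laurentMap B (potential A) = fermatLaurent ι d := by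
  rw [laurentMap_potential_eq_sum]
  simp only [vecMul_row_of_mul_eq hAB, fermatLaurent]

theorem vecMul_injective_of_mul_eq {A B : Matrix ι ι ℤ} {d : ℕ} (hd : 0 < d)
    (hBA : B * A = (d : ℤ) • 1) : Function.Injective fun m => Matrix.vecMul m B := by
  intro m m' h
  have h' := congrArg (fun v => Matrix.vecMul v A) h
  simp only [Matrix.vecMul_vecMul, hBA, Matrix.vecMul_smul, Matrix.vecMul_one] at h'
  exact smul_right_injective _ (by exact_mod_cast hd.ne') h'

theorem comapDomain_laurentMap (B : Matrix ι ι ℤ)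
    (hB : Function.Injective fun m => Matrix.vecMul m B) (p : MvPolynomial ι ℂ) :
    AddMonoidAlgebra.comapDomain _ hB (laurentMap B p) = laurentMap 1 p := by
  induction p using MvPolynomial.induction_on' with
  | monomial s c =>
    rw [laurentMap_monomial, laurentMap_monomial, Matrix.vecMul_one]
    exact AddMonoidAlgebra.comapDomain_single_map _ hB _ _
  | add p q hp hq => rw [map_add, map_add, AddMonoidAlgebra.comapDomain_add, hp, hq]

theorem comapDomain_fermatLaurent_mul {A : Matrix ι ι ℕ} {B : Matrix ι ι ℤ} {d : ℕ}
    (hAB : A.map (Nat.cast : ℕ → ℤ) * B = (d : ℤ) • 1)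
    (hB : Function.Injective fun m => Matrix.vecMul m B) (v : Laurent ι) :
    AddMonoidAlgebra.comapDomain _ hB (fermatLaurent ι d * v) =
      laurentMap 1 (potential A) * AddMonoidAlgebra.comapDomain _ hB v := by
  rw [← laurentMap_potential hAB, laurentMap_potential_eq_sum, laurentMap_potential_eq_sum,
    Finset.sum_mul, Finset.sum_mul]
  refine (map_sum (AddMonoidAlgebra.comapDomainAddMonoidHom _ hB) _ _).trans
    (Finset.sum_congr rfl fun i _ => ?_)
  rw [Matrix.vecMul_one]
  exact comapDomain_lmon_mul B hB _ v

/-- At the point with `x_j = 0` and all other coordinates `1`, the value of `F_A` is the number of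
its monomials that are free of `x_j`, and this number is not zero. -/
theorem not_X_dvd_potential {A : Matrix ι ι ℕ} {j : ι} (hj : ∃ i, A i j = 0) :
    ¬ (X j : MvPolynomial ι ℂ) ∣ potential A := by
  rintro ⟨h, hh⟩
  have h' := congrArg (eval fun k => if k = j then (0 : ℂ) else 1) hh
  rw [map_mul, eval_X, if_pos rfl, zero_mul, potential, map_sum] at h'
  have h1 : ∀ i, eval (fun k => if k = j then (0 : ℂ) else 1) (∏ k, (X k : MvPolynomial ι ℂ) ^ A i k)
      = ((if A i j = 0 then 1 else 0 : ℕ) : ℂ) := by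
    intro i
    rw [map_prod, Finset.prod_eq_single j]
    · by_cases h0 : A i j = 0 <;> simp [h0]
    · intro k _ hk
      simp [hk]
    · simp
  simp only [h1] at h'
  rw [← Nat.cast_sum, Nat.cast_eq_zero, Finset.sum_eq_zero_iff] at h'
  obtain ⟨i, hi⟩ := hj
  simpa [hi] using h' i (Finset.mem_univ i)

theorem isRelPrime_potential_prod_X {A : Matrix ι ι ℕ} (hA : ∀ j, ∃ i, A i j = 0) (N : ℕ) :
    IsRelPrime (potential A) ((∏ j, (X j : MvPolynomial ι ℂ)) ^ N) := by
  refine IsRelPrime.pow_right (IsRelPrime.prod_right fun j _ => IsRelPrime.symm ?_)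
  exact (X_prime (R := ℂ)).irreducible.isRelPrime_iff_not_dvd.mpr (not_X_dvd_potential (hA j))

/-- Projecting the cofactor to the sublattice of the `mB` turns divisibility by the Fermat
polynomial into divisibility by `F_A` among Laurent polynomials in `x`. Clearing denominators leaves
a power of `∏ x_j`, which can be dropped because it is coprime to `F_A`. -/
theorem potential_dvd_of_laurentMap_mem {A : Matrix ι ι ℕ} {B : Matrix ι ι ℤ} {d : ℕ}
    (hAB : A.map (Nat.cast : ℕ → ℤ) * B = (d : ℤ) • 1)
    (hB : Function.Injective fun m => Matrix.vecMul m B) (hA : ∀ j, ∃ i, A i j = 0)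
    {p : MvPolynomial ι ℂ} (hp : fermatLaurent ι d ∣ laurentMap B p) : potential A ∣ p := by
  obtain ⟨v, hv⟩ := hp
  have h := congrArg (AddMonoidAlgebra.comapDomain _ hB) hv
  rw [comapDomain_laurentMap, comapDomain_fermatLaurent_mul hAB hB] at h
  obtain ⟨N, w, hw⟩ := exists_lmon_mul_eq (AddMonoidAlgebra.comapDomain _ hB v)
  have hmon : laurentMap (1 : Matrix ι ι ℤ) ((∏ j, X j) ^ N) = lmon (fun _ => (N : ℤ)) := by
    rw [map_pow, map_prod]
    simp only [laurentMap, aeval_X]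
    have h1 : ∑ j, (1 : Matrix ι ι ℤ) j = fun _ => (1 : ℤ) := by
      funext k
      exact (Finset.sum_apply k _ _).trans (by simp [Matrix.one_apply])
    rw [lmon_sum Finset.univ fun j => (1 : Matrix ι ι ℤ) j, lmon_pow, h1]
    congr 1
    funext k
    simp
  have h2 : (∏ j, X j) ^ N * p = potential A * w := by
    refine laurentMap_one_injective ?_
    rw [map_mul, map_mul, hmon, ← hw, h]
    ring
  exact (isRelPrime_potential_prod_X hA N).dvd_of_dvd_mul_left ⟨w, h2⟩

end Laurent

/-! ### Characters of the torus and invariant monomials -/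

section Characters

variable {ι : Type} [Fintype ι]

/-- The value at `g` of the character of the torus with exponent `m`. -/
def character (g : ι → ℂˣ) (m : ι → ℤ) : ℂˣ := ∏ j, g j ^ m j

theorem character_add (g : ι → ℂˣ) (m m' : ι → ℤ) :
    character g (m + m') = character g m * character g m' := by
  simp [character, zpow_add, Finset.prod_mul_distrib]

theorem character_neg (g : ι → ℂˣ) (m : ι → ℤ) : character g (-m) = (character g m)⁻¹ := by
  simp [character]

theorem character_zero (g : ι → ℂˣ) : character g 0 = 1 := by
  simp [character]

theorem character_smul (g : ι → ℂˣ) (c : ℤ) (m : ι → ℤ) :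
    character g (c • m) = character g m ^ c := by
  simp only [character, Pi.smul_apply, smul_eq_mul, ← Finset.prod_zpow]
  refine Finset.prod_congr rfl fun j _ => ?_
  rw [mul_comm, zpow_mul]

theorem character_sum {κ : Type} (g : ι → ℂˣ) (s : Finset κ) (m : κ → ι → ℤ) :
    character g (∑ i ∈ s, m i) = ∏ i ∈ s, character g (m i) := by
  classical
  induction s using Finset.induction_on with
  | empty => simp [character_zero]
  | insert a s ha ih => rw [Finset.prod_insert ha, Finset.sum_insert ha, character_add, ih]

theorem character_mul (g h : ι → ℂˣ) (m : ι → ℤ) :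
    character (g * h) m = character g m * character h m := by
  simp [character, mul_zpow, Finset.prod_mul_distrib]

theorem character_vecMul (g : ι → ℂˣ) (m : ι → ℤ) (B : Matrix ι ι ℤ) :
    character g (Matrix.vecMul m B) = ∏ j, character g (B j) ^ m j := by
  rw [Matrix.vecMul_eq_sum, character_sum]
  simp only [character_smul]

theorem shiodaPush_apply (B : Matrix ι ι ℤ) (g : ι → ℂˣ) (j : ι) :
    shiodaPush B g j = character g (B j) := rfl

theorem character_shiodaPush (B : Matrix ι ι ℤ) (g : ι → ℂˣ) (m : ι → ℤ) :
    character (shiodaPush B g) m = character g (Matrix.vecMul m B) := by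
  rw [character_vecMul]
  rfl

theorem coeff_torusAct (g : ι → ℂˣ) (p : MvPolynomial ι ℂ) (s : ι →₀ ℕ) :
    coeff s (torusAct g p) = coeff s p * (character g fun j => (s j : ℤ) : ℂˣ) := by
  classical
  induction p using MvPolynomial.induction_on' with
  | monomial t c =>
    have h : torusAct g (monomial t c) =
        monomial t (c * (character g fun j => (t j : ℤ) : ℂˣ)) := by
      rw [torusAct, aeval_monomial, Finsupp.prod_fintype _ _ (by simp)]
      simp only [mul_pow, Finset.prod_mul_distrib, ← map_pow, ← map_prod, algebraMap_eq]
      rw [← mul_assoc, ← map_mul, MvPolynomial.monomial_eq, Finsupp.prod_fintype _ _ (by simp)]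
      simp [character]
    rw [h, coeff_monomial, coeff_monomial]
    split_ifs with hts
    · rw [hts]
    · simp
  | add p q hp hq => rw [map_add, coeff_add, coeff_add, hp, hq, add_mul]

theorem potential_eq_sum_monomial (A : Matrix ι ι ℕ) :
    potential A = ∑ i, monomial (Finsupp.equivFunOnFinite.symm (A i)) (1 : ℂ) := by
  rw [potential]
  refine Finset.sum_congr rfl fun i _ => ?_
  rw [MvPolynomial.monomial_eq, Finsupp.prod_fintype _ _ (by simp)]
  simp

/-- As the rows are distinct, no two monomials of `F_A` merge, so invariance can be read off
coefficient by coefficient. -/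
theorem mem_diagAut_iff {A : Matrix ι ι ℕ} (hA : Function.Injective A) (g : ι → ℂˣ) :
    g ∈ diagAut A ↔ ∀ i, character g (fun j => (A i j : ℤ)) = 1 := by
  classical
  constructor
  · intro hg i
    have h := congrArg (coeff (Finsupp.equivFunOnFinite.symm (A i))) (torusAct_potential A hg)
    have h1 : coeff (Finsupp.equivFunOnFinite.symm (A i)) (potential A) = 1 := by
      rw [potential_eq_sum_monomial, coeff_sum, Finset.sum_eq_single i]
      · simp
      · intro k _ hk
        rw [coeff_monomial, if_neg]
        exact fun he => hk (hA (Finsupp.equivFunOnFinite.symm.injective he))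
      · simp
    rw [coeff_torusAct, h1, one_mul] at h
    exact Units.ext h
  · intro h x
    simp only [potential, map_sum, map_prod, map_pow, eval_X, mul_pow, Finset.prod_mul_distrib]
    refine Finset.sum_congr rfl fun i _ => ?_
    have := congrArg Units.val (h i)
    simp only [character, zpow_natCast, Units.coe_prod, Units.val_pow_eq_pow_val,
      Units.val_one] at this
    rw [this, one_mul]

/-- The exponents of the Laurent monomials that are invariant under `G ∩ Aut(F_A)`. -/
def invariantExponents (A : Matrix ι ι ℕ) (G : Subgroup (ι → ℂˣ)) : Set (ι → ℤ) :=
  {m | ∀ g ∈ diagAut A, g ∈ G → character g m = 1}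

/-- A homogeneous invariant of the coordinate ring is the class of a homogeneous polynomial
all of whose monomials are invariant. -/
theorem exists_invariant_lift {A : Matrix ι ι ℕ} (hfin : Finite (diagAut A)) (q : ι → ℕ)
    (G : Subgroup (ι → ℂˣ)) (D : ℕ) {x : CoordRing A} (hx : x ∈ invariants A G)
    (hxD : x ∈ coordGrading A q D) :
    ∃ p ∈ weightedHomogeneousSubmodule ℂ q D, Ideal.Quotient.mk (Ideal.span {potential A}) p = x ∧
      ∀ s ∈ p.support, (fun j => (s j : ℤ)) ∈ invariantExponents A G := by
  obtain ⟨p₀, hp₀, rfl⟩ := hxD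
  let K : Subgroup (diagAut A) := G.comap (diagAut A).subtype
  have := Fintype.ofFinite K
  have hK : (Fintype.card K : ℂ) ≠ 0 := by exact_mod_cast Fintype.card_ne_zero
  -- The lift is the average of an arbitrary homogeneous lift over the finite group `K`.
  refine ⟨(Fintype.card K : ℂ)⁻¹ • ∑ g : K, torusAct g.1.1 p₀,
    Submodule.smul_mem _ _ (Submodule.sum_mem _ fun g _ => torusAct_mem _ _ _ hp₀), ?_, ?_⟩
  · have h : ∀ g : K, Ideal.Quotient.mkₐ ℂ (Ideal.span {potential A}) (torusAct g.1.1 p₀) =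
        Ideal.Quotient.mkₐ ℂ (Ideal.span {potential A}) p₀ := fun g => hx g.1 g.2
    change Ideal.Quotient.mkₐ ℂ (Ideal.span {potential A}) _ = _
    rw [map_smul, map_sum]
    simp only [h]
    rw [Finset.sum_const, Finset.card_univ, ← Nat.cast_smul_eq_nsmul ℂ, smul_smul,
      inv_mul_cancel₀ hK, one_smul]
    rfl
  · intro s hs g hg hgG
    rw [mem_support_iff, coeff_smul, coeff_sum] at hs
    simp only [coeff_torusAct] at hs
    rw [← Finset.mul_sum] at hs
    -- After averaging, the coefficient of a monomial carries the sum over `K` of its character as a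
    -- factor. This sum vanishes unless the character is trivial.
    let φ : K →* ℂ := (Units.coeHom ℂ).comp
      (MonoidHom.mk' (fun g : K => character g.1.1 fun j => (s j : ℤ))
        fun g h => character_mul _ _ _)
    have hφ : φ = 1 := by
      by_contra hne
      refine hs ?_
      rw [show ∑ g : K, ((character g.1.1 fun j => (s j : ℤ) : ℂˣ) : ℂ) = 0 from
        sum_hom_units_eq_zero φ hne, mul_zero, smul_zero]
    exact Units.ext (DFunLike.congr_fun hφ (⟨⟨g, hg⟩, hgG⟩ : K))

variable [DecidableEq ι]

theorem rows_injective_of_mul_eq {A : Matrix ι ι ℕ} {B : Matrix ι ι ℤ} {d : ℕ} (hd : 0 < d)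
    (hAB : A.map (Nat.cast : ℕ → ℤ) * B = (d : ℤ) • 1) : Function.Injective A := by
  intro i k hik
  have h := (vecMul_row_of_mul_eq hAB i).symm.trans
    ((congrArg (fun v : ι → ℕ => Matrix.vecMul (fun j => (v j : ℤ)) B) hik).trans
      (vecMul_row_of_mul_eq hAB k))
  have h' := congrFun h i
  by_contra hne
  simp [hne] at h'
  omega

/-- Since `BA = dI`, the monomial `x_j ^ d` is a product of integer powers of the monomials of
`F_A`, each of which is invariant. -/
theorem pow_eq_one_of_mem_diagAut {A : Matrix ι ι ℕ} {B : Matrix ι ι ℤ} {d : ℕ} (hd : 0 < d)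
    (hAB : A.map (Nat.cast : ℕ → ℤ) * B = (d : ℤ) • 1)
    (hBA : B * A.map (Nat.cast : ℕ → ℤ) = (d : ℤ) • 1) {g : ι → ℂˣ} (hg : g ∈ diagAut A) (j : ι) :
    g j ^ d = 1 := by
  rw [mem_diagAut_iff (rows_injective_of_mul_eq hd hAB)] at hg
  have h1 : Matrix.vecMul (B j) (A.map (Nat.cast : ℕ → ℤ)) = (d : ℤ) • Pi.single j 1 := by
    ext k
    have h := congrFun (congrFun hBA j) k
    simpa [Matrix.mul_apply, Matrix.vecMul, dotProduct, Matrix.one_apply, Pi.single_apply,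
      eq_comm] using h
  have h2 := character_vecMul g (B j) (A.map (Nat.cast : ℕ → ℤ))
  rw [h1, character_smul] at h2
  have h3 : character g (Pi.single j 1) = g j := by
    rw [character, Finset.prod_eq_single j]
    · simp
    · intro k _ hk; simp [hk]
    · simp
  rw [h3, zpow_natCast] at h2
  rw [h2]
  refine Finset.prod_eq_one fun i _ => ?_
  have := hg i
  change character g (A.map (Nat.cast : ℕ → ℤ) i) = 1 at this
  rw [this, one_zpow]

theorem finite_diagAut {A : Matrix ι ι ℕ} {B : Matrix ι ι ℤ} {d : ℕ} (hd : 0 < d)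
    (hAB : A.map (Nat.cast : ℕ → ℤ) * B = (d : ℤ) • 1)
    (hBA : B * A.map (Nat.cast : ℕ → ℤ) = (d : ℤ) • 1) : Finite (diagAut A) := by
  have : NeZero d := ⟨hd.ne'⟩
  refine Finite.of_injective (β := ι → rootsOfUnity d ℂ)
    (fun g j => ⟨g.1 j, pow_eq_one_of_mem_diagAut hd hAB hBA g.2 j⟩) ?_
  intro g h hgh
  exact Subtype.ext (funext fun j => congrArg Subtype.val (congrFun hgh j))

end Characters

/-! ### Pullback along the Shioda map and the function ring of the torus part -/

section CoordMap

variable {ι : Type} [Fintype ι] [DecidableEq ι]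

/-- The coordinate ring of the Fermat hypersurface intersected with the torus. -/
abbrev FermatTorus (ι : Type) [Fintype ι] [DecidableEq ι] (d : ℕ) : Type :=
  Laurent ι ⧸ Ideal.span {fermatLaurent ι d}

/-- The class of a Laurent monomial on the Fermat hypersurface. -/
noncomputable def fmon (d : ℕ) (m : ι → ℤ) : FermatTorus ι d :=
  Ideal.Quotient.mk (Ideal.span {fermatLaurent ι d}) (lmon m)

theorem fmon_mul (d : ℕ) (m m' : ι → ℤ) : fmon d m * fmon d m' = fmon d (m + m') := by
  rw [fmon, fmon, fmon, ← map_mul, lmon_mul_lmon]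

theorem fmon_pow (d : ℕ) (m : ι → ℤ) (n : ℕ) : fmon d m ^ n = fmon d (n • m) := by
  rw [fmon, fmon, ← map_pow, lmon_pow]

theorem isUnit_fmon (d : ℕ) (m : ι → ℤ) : IsUnit (fmon d m) :=
  (isUnit_lmon m).map _

variable {A : Matrix ι ι ℕ} {B : Matrix ι ι ℤ} {d : ℕ}

/-- The pullback of functions along the Shioda map `φ_B`. -/
noncomputable def coordMap (hAB : A.map (Nat.cast : ℕ → ℤ) * B = (d : ℤ) • 1) :
    CoordRing A →ₐ[ℂ] FermatTorus ι d :=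
  Ideal.Quotient.liftₐ _ ((Ideal.Quotient.mkₐ ℂ _).comp (laurentMap B)) (by
    intro p hp
    rw [Ideal.mem_span_singleton] at hp
    rw [AlgHom.comp_apply, Ideal.Quotient.mkₐ_eq_mk, Ideal.Quotient.eq_zero_iff_mem,
      Ideal.mem_span_singleton, ← laurentMap_potential hAB]
    exact map_dvd _ hp)

theorem coordMap_mk (hAB : A.map (Nat.cast : ℕ → ℤ) * B = (d : ℤ) • 1) (p : MvPolynomial ι ℂ) :
    coordMap hAB (Ideal.Quotient.mk _ p) =
      ∑ s ∈ p.support, coeff s p • fmon d (Matrix.vecMul (fun j => (s j : ℤ)) B) := by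
  change Ideal.Quotient.mkₐ ℂ (Ideal.span {fermatLaurent ι d}) (laurentMap B p) = _
  conv_lhs => rw [p.as_sum]
  rw [map_sum, map_sum]
  refine Finset.sum_congr rfl fun s _ => ?_
  have h : laurentMap B (monomial s (coeff s p)) =
      coeff s p • lmon (Matrix.vecMul (fun j => (s j : ℤ)) B) := by
    rw [laurentMap_monomial, lmon, AddMonoidAlgebra.smul_single, smul_eq_mul, mul_one]
  rw [h, map_smul]
  rfl

theorem coordMap_mk_monomial (hAB : A.map (Nat.cast : ℕ → ℤ) * B = (d : ℤ) • 1) (s : ι →₀ ℕ) :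
    coordMap hAB (Ideal.Quotient.mk _ (monomial s 1)) =
      fmon d (Matrix.vecMul (fun j => (s j : ℤ)) B) := by
  rw [coordMap_mk, support_monomial, if_neg one_ne_zero, Finset.sum_singleton, coeff_monomial,
    if_pos rfl, one_smul]

theorem coordMap_injective (hAB : A.map (Nat.cast : ℕ → ℤ) * B = (d : ℤ) • 1)
    (hB : Function.Injective fun m => Matrix.vecMul m B) (hA : ∀ j, ∃ i, A i j = 0) :
    Function.Injective (coordMap hAB) := by
  rw [injective_iff_map_eq_zero]
  intro x hx
  obtain ⟨p, rfl⟩ := Ideal.Quotient.mk_surjective x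
  change Ideal.Quotient.mk (Ideal.span {fermatLaurent ι d}) (laurentMap B p) = 0 at hx
  rw [Ideal.Quotient.eq_zero_iff_mem, Ideal.mem_span_singleton] at hx
  rw [Ideal.Quotient.eq_zero_iff_mem, Ideal.mem_span_singleton]
  exact potential_dvd_of_laurentMap_mem hAB hB hA hx

omit [DecidableEq ι] in
theorem mk_monomial_mem_invariants {G : Subgroup (ι → ℂˣ)} {s : ι →₀ ℕ}
    (hs : (fun j => (s j : ℤ)) ∈ invariantExponents A G) :
    Ideal.Quotient.mk (Ideal.span {potential A}) (monomial s 1) ∈ invariants A G := by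
  classical
  intro g hg
  change Ideal.Quotient.mk (Ideal.span {potential A}) (torusAct g.1 (monomial s 1)) = _
  congr 1
  ext t
  rw [coeff_torusAct, coeff_monomial]
  split_ifs with h
  · subst h
    rw [hs g.1 g.2 hg, Units.val_one, mul_one]
  · rw [zero_mul]

omit [DecidableEq ι] in
theorem mk_monomial_mem_coordGrading (A : Matrix ι ι ℕ) (q : ι → ℕ) {s : ι →₀ ℕ} {D : ℕ}
    (hs : ∑ j, s j * q j = D) :
    Ideal.Quotient.mk (Ideal.span {potential A}) (monomial s 1) ∈ coordGrading A q D := by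
  refine ⟨monomial s 1, ?_, rfl⟩
  refine (mem_weightedHomogeneousSubmodule ..).mpr (isWeightedHomogeneous_monomial _ _ _ ?_)
  rw [Finsupp.weight_apply, Finsupp.sum_fintype _ _ (by simp)]
  simpa using hs

/-- The exponents of the Laurent monomials in `x` of weight zero that are invariant under `G`. -/
def zeroExponents (A : Matrix ι ι ℕ) (q : ι → ℕ) (G : Subgroup (ι → ℂˣ)) : Set (ι → ℤ) :=
  {m | m ∈ invariantExponents A G ∧ ∑ j, m j * q j = 0}

/-- The invariant `(∏ j, x_j) ^ d`. -/
noncomputable def prodPow (G : Subgroup (ι → ℂˣ)) (hd : 0 < d)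
    (hAB : A.map (Nat.cast : ℕ → ℤ) * B = (d : ℤ) • 1)
    (hBA : B * A.map (Nat.cast : ℕ → ℤ) = (d : ℤ) • 1) : invariants A G :=
  ⟨Ideal.Quotient.mk _ (monomial (Finsupp.equivFunOnFinite.symm fun _ => d) 1),
    -- The exponent `d` makes the monomial invariant under all of `Aut(F_A)`, whose elements have
    -- `d`-th roots of unity as coordinates.
    mk_monomial_mem_invariants fun g hg _ => by
      simpa [character] using Finset.prod_eq_one fun j _ =>
        pow_eq_one_of_mem_diagAut hd hAB hBA hg j⟩

theorem coordMap_prodPow_pow (G : Subgroup (ι → ℂˣ)) (hd : 0 < d)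
    (hAB : A.map (Nat.cast : ℕ → ℤ) * B = (d : ℤ) • 1)
    (hBA : B * A.map (Nat.cast : ℕ → ℤ) = (d : ℤ) • 1) (n : ℕ) :
    coordMap hAB (prodPow G hd hAB hBA : CoordRing A) ^ n =
      fmon d (Matrix.vecMul (fun _ => ((n * d : ℕ) : ℤ)) B) := by
  rw [prodPow, coordMap_mk_monomial, fmon_pow, ← Matrix.smul_vecMul]
  congr 2

theorem prodPow_mem (q : ι → ℕ) (G : Subgroup (ι → ℂˣ)) (hd : 0 < d)
    (hAB : A.map (Nat.cast : ℕ → ℤ) * B = (d : ℤ) • 1)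
    (hBA : B * A.map (Nat.cast : ℕ → ℤ) = (d : ℤ) • 1) :
    prodPow G hd hAB hBA ∈ invGrading A q G (d * ∑ j, q j) :=
  mk_monomial_mem_coordGrading A q (by simp [Finset.mul_sum])

theorem isUnit_coordMap_prodPow (G : Subgroup (ι → ℂˣ)) (hd : 0 < d)
    (hAB : A.map (Nat.cast : ℕ → ℤ) * B = (d : ℤ) • 1)
    (hBA : B * A.map (Nat.cast : ℕ → ℤ) = (d : ℤ) • 1) :
    IsUnit (coordMap hAB (prodPow G hd hAB hBA : CoordRing A)) := by
  rw [← pow_one (coordMap hAB (prodPow G hd hAB hBA : CoordRing A)), coordMap_prodPow_pow]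
  exact isUnit_fmon _ _

/-- The functions on the part of the quotient of the hypersurface that lies in the torus are spanned
by the invariant Laurent monomials of weight zero. -/
theorem awayRange_invGrading {q : ι → ℕ} (hq : IsWeightSystem A q d)
    (G : Subgroup (ι → ℂˣ)) (hd : 0 < d)
    (hAB : A.map (Nat.cast : ℕ → ℤ) * B = (d : ℤ) • 1)
    (hBA : B * A.map (Nat.cast : ℕ → ℤ) = (d : ℤ) • 1) :
    awayRange (invGrading A q G) (prodPow G hd hAB hBA) (d * ∑ j, q j)
      (((coordMap hAB).comp (invariants A G).val : invariants A G →ₐ[ℂ] FermatTorus ι d) :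
        invariants A G →+* FermatTorus ι d) =
      Submodule.span ℂ ((fun m => fmon d (Matrix.vecMul m B)) '' zeroExponents A q G) := by
  ext l
  constructor
  · rintro ⟨n, ⟨a, haG⟩, ha, h⟩
    change l * coordMap hAB (prodPow G hd hAB hBA : CoordRing A) ^ n = coordMap hAB a at h
    -- With a numerator all of whose monomials are invariant, the fraction can be divided out term
    -- by term.
    obtain ⟨p, hp, rfl, hpG⟩ :=
      exists_invariant_lift (finite_diagAut hd hAB hBA) q G _ haG ha
    rw [coordMap_prodPow_pow, coordMap_mk] at h
    have hl : l = ∑ s ∈ p.support, coeff s p •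
        fmon d (Matrix.vecMul ((fun j => (s j : ℤ)) - fun _ => ((n * d : ℕ) : ℤ)) B) := by
      refine (isUnit_fmon d (Matrix.vecMul (fun _ => ((n * d : ℕ) : ℤ)) B)).mul_right_cancel ?_
      rw [h, Finset.sum_mul]
      refine Finset.sum_congr rfl fun s _ => ?_
      rw [smul_mul_assoc, fmon_mul, ← Matrix.add_vecMul, sub_add_cancel]
    rw [hl]
    refine Submodule.sum_mem _ fun s hs => Submodule.smul_mem _ _ (Submodule.subset_span
      ⟨_, ⟨fun g hg hgG => ?_, ?_⟩, rfl⟩)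
    · rw [sub_eq_add_neg, character_add, character_neg, hpG s hs g hg hgG, one_mul, inv_eq_one]
      refine Finset.prod_eq_one fun j _ => ?_
      rw [zpow_natCast, mul_comm, pow_mul, pow_eq_one_of_mem_diagAut hd hAB hBA hg, one_pow]
    · have hw : Finsupp.weight q s = n • (d * ∑ j, q j) :=
        ((mem_weightedHomogeneousSubmodule ..).mp hp) (mem_support_iff.mp hs)
      rw [Finsupp.weight_apply, Finsupp.sum_fintype _ _ (by simp)] at hw
      have hw' : (∑ j, (s j : ℤ) * q j) = n * (d * ∑ j, (q j : ℤ)) := by exact_mod_cast hw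
      simp only [Pi.sub_apply, sub_mul, Finset.sum_sub_distrib, hw', ← Finset.mul_sum]
      push_cast
      ring
  · let := invGradedAlgebra A q d hq G
    refine fun hl => span_subset_awayRange (invGrading A q G) (prodPow_mem q G hd hAB hBA)
      ((coordMap hAB).comp (invariants A G).val) ?_ hl
    rintro _ ⟨m, ⟨hmG, hm⟩, rfl⟩
    -- Adding a large multiple of `d` to every exponent produces an honest monomial and does not
    -- change invariance.
    have hn : ∀ j, 0 ≤ m j + ((∑ j, (m j).natAbs) * d : ℕ) := by
      intro j
      have h : (m j).natAbs ≤ (∑ j, (m j).natAbs) * d :=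
        (Finset.single_le_sum (f := fun j => (m j).natAbs) (fun _ _ => Nat.zero_le _)
          (Finset.mem_univ j)).trans (Nat.le_mul_of_pos_right _ hd)
      omega
    generalize ∑ j, (m j).natAbs = n at hn
    let s : ι →₀ ℕ := Finsupp.equivFunOnFinite.symm fun j => (m j + (n * d : ℕ)).toNat
    have hs : (fun j => (s j : ℤ)) = m + fun _ => ((n * d : ℕ) : ℤ) :=
      funext fun j => Int.toNat_of_nonneg (hn j)
    have hsG : (fun j => (s j : ℤ)) ∈ invariantExponents A G := by
      intro g hg hgG
      rw [hs, character_add, hmG g hg hgG, one_mul]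
      refine Finset.prod_eq_one fun j _ => ?_
      rw [zpow_natCast, mul_comm, pow_mul, pow_eq_one_of_mem_diagAut hd hAB hBA hg, one_pow]
    refine ⟨n, ⟨_, mk_monomial_mem_invariants hsG⟩,
      mk_monomial_mem_coordGrading A q (s := s) ?_, ?_⟩
    · have h : (∑ j, (s j : ℤ) * q j) = n * (d * ∑ j, (q j : ℤ)) := by
        have h' : ∀ j, (s j : ℤ) = m j + n * d := fun j =>
          (congrFun hs j).trans (by simp)
        simp only [h', add_mul, Finset.sum_add_distrib, hm, ← Finset.mul_sum]
        ring
      rw [smul_eq_mul]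
      exact_mod_cast h
    · change fmon d (Matrix.vecMul m B) * coordMap hAB (prodPow G hd hAB hBA : CoordRing A) ^ n =
        coordMap hAB (Ideal.Quotient.mk _ (monomial s 1))
      rw [coordMap_prodPow_pow, coordMap_mk_monomial, fmon_mul, ← Matrix.add_vecMul, hs]

/-- Quotients of hypersurfaces are birational if the Shioda maps to them from the same Fermat
hypersurface identify the invariant Laurent monomials of weight zero. -/
theorem birationalOver_orbifold [Nonempty ι] {A' : Matrix ι ι ℕ} {B' : Matrix ι ι ℤ}
    {q q' : ι → ℕ} (hq : IsWeightSystem A q d) (hq' : IsWeightSystem A' q' d)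
    (hqpos : ∀ j, 0 < q j) (hqpos' : ∀ j, 0 < q' j) (G G' : Subgroup (ι → ℂˣ)) (hd : 0 < d)
    (hAB : A.map (Nat.cast : ℕ → ℤ) * B = (d : ℤ) • 1)
    (hBA : B * A.map (Nat.cast : ℕ → ℤ) = (d : ℤ) • 1)
    (hAB' : A'.map (Nat.cast : ℕ → ℤ) * B' = (d : ℤ) • 1)
    (hBA' : B' * A'.map (Nat.cast : ℕ → ℤ) = (d : ℤ) • 1)
    (hA : ∀ j, ∃ i, A i j = 0) (hA' : ∀ j, ∃ i, A' i j = 0)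
    (h : (fun m => Matrix.vecMul m B) '' zeroExponents A q G =
      (fun m => Matrix.vecMul m B') '' zeroExponents A' q' G') :
    Scheme.BirationalOver (orbifoldToSpec A q d hq G) (orbifoldToSpec A' q' d hq' G') := by
  let := invGradedAlgebra A q d hq G
  let := invGradedAlgebra A' q' d hq' G'
  have hpos : ∀ {w : ι → ℕ}, (∀ j, 0 < w j) → 0 < d * ∑ j, w j := fun hw =>
    Nat.mul_pos hd (Finset.sum_pos (fun j _ => hw j) Finset.univ_nonempty)
  refine birationalOver_of_awayRange_eq (invGrading A q G) (invGrading A' q' G')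
    (prodPow_mem q G hd hAB hBA) (prodPow_mem q' G' hd hAB' hBA') (hpos hqpos) (hpos hqpos')
    ((coordMap hAB).comp (invariants A G).val) ((coordMap hAB').comp (invariants A' G').val)
    ((coordMap_injective hAB (vecMul_injective_of_mul_eq hd hBA) hA).comp
      Subtype.val_injective)
    ((coordMap_injective hAB' (vecMul_injective_of_mul_eq hd hBA') hA').comp
      Subtype.val_injective)
    (isUnit_coordMap_prodPow G hd hAB hBA) (isUnit_coordMap_prodPow G' hd hAB' hBA') ?_
  rw [awayRange_invGrading hq, awayRange_invGrading hq', ← Function.comp_def (fmon d),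
    ← Function.comp_def (fmon d), Set.image_comp, Set.image_comp, h]

end CoordMap

/-! ### The groups of `d`-th roots of unity, written additively -/

section RootsOfUnity

/-- `exp (2πi x / d)` as a unit. -/
noncomputable def rootChar (d : ℕ) (x : ℤ) : ℂˣ := pr d (fun _ : Unit => x) ()

theorem pr_apply {κ : Type} (d : ℕ) (h : κ → ℤ) (j : κ) : pr d h j = rootChar d (h j) := rfl

theorem rootChar_zero (d : ℕ) : rootChar d 0 = 1 := congrFun (pr_zero (κ := Unit) d) ()

theorem rootChar_add (d : ℕ) (x y : ℤ) : rootChar d (x + y) = rootChar d x * rootChar d y :=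
  congrFun (pr_add (κ := Unit) d (fun _ => x) (fun _ => y)) ()

theorem rootChar_neg (d : ℕ) (x : ℤ) : rootChar d (-x) = (rootChar d x)⁻¹ :=
  congrFun (pr_neg (κ := Unit) d (fun _ => x)) ()

theorem rootChar_mul (d : ℕ) (x n : ℤ) : rootChar d (n * x) = rootChar d x ^ n := by
  induction n using Int.induction_on with
  | zero => simp [rootChar_zero]
  | succ n ih => rw [add_mul, one_mul, rootChar_add, ih, zpow_add_one]
  | pred n ih => rw [sub_mul, one_mul, sub_eq_add_neg, rootChar_add, ih, rootChar_neg, zpow_sub_one]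

theorem rootChar_sum (d : ℕ) {κ : Type} (s : Finset κ) (x : κ → ℤ) :
    rootChar d (∑ i ∈ s, x i) = ∏ i ∈ s, rootChar d (x i) := by
  classical
  induction s using Finset.induction_on with
  | empty => simp [rootChar_zero]
  | insert a s ha ih => rw [Finset.prod_insert ha, Finset.sum_insert ha, rootChar_add, ih]

theorem rootChar_eq_one_iff {d : ℕ} (hd : 0 < d) (x : ℤ) : rootChar d x = 1 ↔ (d : ℤ) ∣ x := by
  have hd' : (d : ℂ) ≠ 0 := by exact_mod_cast hd.ne'
  have h2 : (2 * Real.pi * Complex.I : ℂ) ≠ 0 := Complex.two_pi_I_ne_zero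
  rw [← Units.val_inj, rootChar, pr, Units.val_mk0, Units.val_one, Complex.exp_eq_one_iff]
  refine exists_congr fun n => ?_
  rw [div_eq_iff hd']
  constructor
  · intro h
    have : (x : ℂ) = d * n := mul_left_cancel₀ h2 (by rw [h]; ring)
    exact_mod_cast this
  · rintro rfl
    push_cast
    ring

theorem exists_rootChar_eq {d : ℕ} (hd : 0 < d) {z : ℂˣ} (hz : z ^ d = 1) :
    ∃ x : ℤ, rootChar d x = z := by
  have : NeZero d := ⟨hd.ne'⟩
  obtain ⟨i, -, hi⟩ := (Complex.mem_rootsOfUnity d z).mp hz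
  refine ⟨i, Units.ext ?_⟩
  rw [← hi, rootChar, pr, Units.val_mk0]
  congr 1
  push_cast
  ring

theorem exists_pr_eq {κ : Type} {d : ℕ} (hd : 0 < d) {g : κ → ℂˣ} (hg : ∀ j, g j ^ d = 1) :
    ∃ h : κ → ℤ, pr d h = g := by
  choose h hh using fun j => exists_rootChar_eq hd (hg j)
  exact ⟨h, funext hh⟩

theorem rootChar_pow_self {d : ℕ} (hd : 0 < d) (x : ℤ) : rootChar d x ^ d = 1 := by
  rw [← zpow_natCast, ← rootChar_mul, rootChar_eq_one_iff hd]
  exact dvd_mul_right _ _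

variable {ι : Type} [Fintype ι]

theorem character_pr (d : ℕ) (h m : ι → ℤ) : character (pr d h) m = rootChar d (m ⬝ᵥ h) := by
  simp only [character, dotProduct, rootChar_sum, rootChar_mul, pr_apply]

theorem shiodaPush_pr (d : ℕ) (B : Matrix ι ι ℤ) (h : ι → ℤ) :
    shiodaPush B (pr d h) = pr d (B.mulVec h) :=
  funext fun j => character_pr d h (B j)

theorem character_const (t : ℂˣ) (m : ι → ℤ) : character (fun _ => t) m = t ^ ∑ j, m j := by
  rw [character]
  classical
  induction (Finset.univ : Finset ι) using Finset.induction_on with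
  | empty => simp
  | insert a s ha ih => rw [Finset.prod_insert ha, Finset.sum_insert ha, zpow_add, ih]

end RootsOfUnity

/-! ### The Shioda map on symmetries and on invariant exponents -/

section Shioda

variable {ι : Type} [Fintype ι] [DecidableEq ι] {A : Matrix ι ι ℕ} {B : Matrix ι ι ℤ} {d : ℕ}

omit [Fintype ι] in
theorem fermat_apply (d : ℕ) (i j : ι) : (fermat d : Matrix ι ι ℕ) i j = if i = j then d else 0 := by
  rw [fermat, Matrix.smul_apply, Matrix.one_apply]
  split_ifs <;> simp

theorem fermat_map_mul_one (d : ℕ) :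
    (fermat d : Matrix ι ι ℕ).map (Nat.cast : ℕ → ℤ) * (1 : Matrix ι ι ℤ) = (d : ℤ) • 1 := by
  ext i j
  simp [fermat_apply, Matrix.one_apply]

theorem one_mul_fermat_map (d : ℕ) :
    (1 : Matrix ι ι ℤ) * (fermat d : Matrix ι ι ℕ).map (Nat.cast : ℕ → ℤ) = (d : ℤ) • 1 := by
  ext i j
  simp [fermat_apply, Matrix.one_apply]

theorem character_smul_single (g : ι → ℂˣ) (d : ℕ) (j : ι) :
    character g ((d : ℤ) • Pi.single j 1) = g j ^ d := by
  rw [character_smul, zpow_natCast, character, Finset.prod_eq_single j]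
  · simp
  · intro k _ hk; simp [hk]
  · simp

theorem mem_diagAut_fermat_iff (hd : 0 < d) (g : ι → ℂˣ) :
    g ∈ diagAut (fermat d) ↔ ∀ j, g j ^ d = 1 := by
  rw [mem_diagAut_iff (rows_injective_of_mul_eq hd (fermat_map_mul_one d))]
  refine forall_congr' fun j => ?_
  have h := vecMul_row_of_mul_eq (fermat_map_mul_one (ι := ι) d) j
  rw [Matrix.vecMul_one] at h
  rw [h, character_smul_single]

theorem pr_mem_diagAut_fermat (hd : 0 < d) (h : ι → ℤ) : pr d h ∈ diagAut (fermat d) :=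
  (mem_diagAut_fermat_iff hd _).mpr fun j => rootChar_pow_self hd (h j)

theorem shiodaPush_mem_diagAut (hd : 0 < d)
    (hAB : A.map (Nat.cast : ℕ → ℤ) * B = (d : ℤ) • 1) {g : ι → ℂˣ}
    (hg : g ∈ diagAut (fermat d)) : shiodaPush B g ∈ diagAut A := by
  rw [mem_diagAut_iff (rows_injective_of_mul_eq hd hAB)]
  intro i
  rw [character_shiodaPush, vecMul_row_of_mul_eq hAB, character_smul_single]
  exact (mem_diagAut_fermat_iff hd g).mp hg i

/-- The Shioda map is onto `Aut(F_A)`: if `g` is `pr d v`, invariance of the monomials of `F_A` says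
that `Av = du` with `u` integral, and then `Bu = v` because `BA = dI`. -/
theorem exists_shiodaPush_pr_eq (hd : 0 < d)
    (hAB : A.map (Nat.cast : ℕ → ℤ) * B = (d : ℤ) • 1)
    (hBA : B * A.map (Nat.cast : ℕ → ℤ) = (d : ℤ) • 1) {g : ι → ℂˣ} (hg : g ∈ diagAut A) :
    ∃ h : ι → ℤ, shiodaPush B (pr d h) = g := by
  obtain ⟨v, rfl⟩ := exists_pr_eq hd (pow_eq_one_of_mem_diagAut hd hAB hBA hg)
  rw [mem_diagAut_iff (rows_injective_of_mul_eq hd hAB)] at hg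
  have hdvd : ∀ i, (d : ℤ) ∣ (fun j => (A i j : ℤ)) ⬝ᵥ v := fun i => by
    rw [← rootChar_eq_one_iff hd, ← character_pr]
    exact hg i
  choose u hu using hdvd
  refine ⟨u, ?_⟩
  rw [shiodaPush_pr]
  congr 1
  have h1 : (A.map (Nat.cast : ℕ → ℤ)).mulVec v = (d : ℤ) • u := funext hu
  have h2 : (d : ℤ) • B.mulVec u = (d : ℤ) • v := by
    rw [← Matrix.mulVec_smul, ← h1, Matrix.mulVec_mulVec, hBA, Matrix.smul_mulVec,
      Matrix.one_mulVec]
  exact smul_right_injective _ (by exact_mod_cast hd.ne') h2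

theorem mulVec_one_eq_weight (hd : 0 < d) (hBA : B * A.map (Nat.cast : ℕ → ℤ) = (d : ℤ) • 1)
    {q : ι → ℕ} (hq : IsWeightSystem A q d) : B.mulVec 1 = fun j => (q j : ℤ) := by
  have h1 : (A.map (Nat.cast : ℕ → ℤ)).mulVec (fun j => (q j : ℤ)) = (d : ℤ) • 1 := by
    ext i
    simpa [Matrix.mulVec, dotProduct] using congrArg (Nat.cast : ℕ → ℤ) (hq i)
  have h2 : (d : ℤ) • B.mulVec 1 = (d : ℤ) • fun j => (q j : ℤ) := by
    rw [← Matrix.mulVec_smul, ← h1, Matrix.mulVec_mulVec, hBA, Matrix.smul_mulVec,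
      Matrix.one_mulVec]
  exact smul_right_injective _ (by exact_mod_cast hd.ne') h2

/-- The `q`-weight of a monomial in `x` is the total degree of its pullback in `y`, because the row
sums of `B` are the weights. -/
theorem dotProduct_weight (hd : 0 < d) (hBA : B * A.map (Nat.cast : ℕ → ℤ) = (d : ℤ) • 1)
    {q : ι → ℕ} (hq : IsWeightSystem A q d) (m : ι → ℤ) :
    ∑ j, m j * q j = ∑ j, Matrix.vecMul m B j := by
  have h := Matrix.dotProduct_mulVec m B 1
  rw [mulVec_one_eq_weight hd hBA hq, dotProduct_one] at h
  exact h

/-- The Shioda map identifies the `G`-invariant Laurent monomials of weight zero with the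
`H`-invariant ones, where `H` is the preimage of `G`. -/
theorem image_zeroExponents (hd : 0 < d)
    (hAB : A.map (Nat.cast : ℕ → ℤ) * B = (d : ℤ) • 1)
    (hBA : B * A.map (Nat.cast : ℕ → ℤ) = (d : ℤ) • 1) {q : ι → ℕ} (hq : IsWeightSystem A q d)
    (G : Subgroup (ι → ℂˣ)) :
    (fun m => Matrix.vecMul m B) '' zeroExponents A q G =
      (fun m => Matrix.vecMul m 1) '' zeroExponents (fermat d) 1 (shiodaPreimage d B G) := by
  simp only [Matrix.vecMul_one, Set.image_id']
  ext m'
  constructor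
  · rintro ⟨m, ⟨hmG, hm⟩, rfl⟩
    refine ⟨fun h hh hhG => ?_, ?_⟩
    · rw [← character_shiodaPush]
      exact hmG _ (shiodaPush_mem_diagAut hd hAB hh) hhG.2
    · simpa [dotProduct_weight hd hBA hq] using hm
  · rintro ⟨hmH, hm⟩
    have hdvd : ∀ j, (d : ℤ) ∣ Matrix.vecMul m' (A.map (Nat.cast : ℕ → ℤ)) j := by
      intro j
      -- By `BA = dI` the columns of `A` give elements of the kernel of the Shioda map. They lie in
      -- `H` for every `G`, and invariance of `m'` under them says that `d` divides `m'A`.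
      have hpush : shiodaPush B (pr d fun i => (A i j : ℤ)) = 1 := by
        rw [shiodaPush_pr]
        funext i
        have h := congrFun (congrFun hBA i) j
        rw [pr_apply, Pi.one_apply, rootChar_eq_one_iff hd]
        change (d : ℤ) ∣ (B * A.map (Nat.cast : ℕ → ℤ)) i j
        rw [h]
        exact dvd_mul_right _ _
      have h := hmH (pr d fun i => (A i j : ℤ)) (pr_mem_diagAut_fermat hd _)
        ⟨pr_mem_diagAut_fermat hd _, by
          change shiodaPush B _ ∈ G
          rw [hpush]
          exact one_mem G⟩
      rw [character_pr, rootChar_eq_one_iff hd] at h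
      exact h
    choose m hmd using hdvd
    have hm1 : Matrix.vecMul m' (A.map (Nat.cast : ℕ → ℤ)) = (d : ℤ) • m := funext hmd
    have hm2 : Matrix.vecMul m B = m' := by
      have hd' : (d : ℤ) ≠ 0 := by exact_mod_cast hd.ne'
      refine smul_right_injective (ι → ℤ) hd' ?_
      change (d : ℤ) • Matrix.vecMul m B = (d : ℤ) • m'
      rw [← Matrix.smul_vecMul, ← hm1, Matrix.vecMul_vecMul, hAB, Matrix.vecMul_smul,
        Matrix.vecMul_one]
    refine ⟨m, ⟨fun g hg hgG => ?_, ?_⟩, hm2⟩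
    -- Surjectivity onto `Aut(F_A)` transfers invariance under `H` back to invariance under `G`.
    · obtain ⟨h, rfl⟩ := exists_shiodaPush_pr_eq hd hAB hBA hg
      rw [character_shiodaPush, hm2]
      exact hmH _ (pr_mem_diagAut_fermat hd _) ⟨pr_mem_diagAut_fermat hd _, hgG⟩
    · rw [dotProduct_weight hd hBA hq, hm2]
      simpa using hm

/-- The quotient of the hypersurface `F_A = 0` by `G` is birational to the quotient of the Fermat
hypersurface by the preimage of `G` under the Shioda map. -/
theorem birationalOver_fermat [Nontrivial ι] (hd : 0 < d)
    (hAB : A.map (Nat.cast : ℕ → ℤ) * B = (d : ℤ) • 1)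
    (hBA : B * A.map (Nat.cast : ℕ → ℤ) = (d : ℤ) • 1) {q : ι → ℕ} (hq : IsWeightSystem A q d)
    (hqpos : ∀ j, 0 < q j) (hA : ∀ j, ∃ i, A i j = 0) (G : Subgroup (ι → ℂˣ)) :
    Scheme.BirationalOver (orbifoldToSpec A q d hq G)
      (orbifoldToSpec (fermat d) 1 d (isWeightSystem_fermat d) (shiodaPreimage d B G)) := by
  refine birationalOver_orbifold hq (isWeightSystem_fermat d) hqpos (fun _ => Nat.one_pos) G _ hd
    hAB hBA (fermat_map_mul_one d) (one_mul_fermat_map d) hA (fun j => ?_)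
    (image_zeroExponents hd hAB hBA hq G)
  obtain ⟨i, hi⟩ := exists_ne j
  exact ⟨i, by simp [fermat_apply, hi]⟩

end Shioda

/-! ### The shape of nondegenerate Calabi–Yau exponent matrices -/

section Nondegenerate

variable {ι : Type} [Fintype ι] [DecidableEq ι] {A : Matrix ι ι ℕ}

omit [DecidableEq ι] in
theorem eval_potential (A : Matrix ι ι ℕ) (x : ι → ℂ) :
    eval x (potential A) = ∑ i, ∏ j, x j ^ A i j := by
  simp [potential]

theorem eval_pderiv_potential (A : Matrix ι ι ℕ) (x : ι → ℂ) (l : ι) :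
    eval x (pderiv l (potential A)) =
      ∑ i, (A i l : ℂ) * ∏ j, x j ^ (A i j - if j = l then 1 else 0) := by
  rw [potential_eq_sum_monomial, map_sum, map_sum]
  refine Finset.sum_congr rfl fun i _ => ?_
  rw [pderiv_monomial, eval_monomial, Finsupp.prod_fintype _ _ (by simp)]
  simp [Finsupp.single_apply, eq_comm]

/-- A polynomial that is nondegenerate has for every variable a monomial that is, up to at most
one factor of degree one, a power of this variable. -/
theorem exists_row_of_isNondegenerate (hnd : IsNondegenerate A) [Nontrivial ι] (k : ι) :
    ∃ i l, l ≠ k ∧ ∀ j, j ≠ k → A i j ≤ if j = l then 1 else 0 := by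
  -- Otherwise every monomial, even after one differentiation, keeps a variable other than `x_k`,
  -- and the `k`-th unit vector is a singular point.
  by_contra! hcon
  have hx : (Pi.single k 1 : ι → ℂ) ≠ 0 := by simp
  refine hx ((hnd _).mp ⟨?_, fun l => ?_⟩)
  · rw [eval_potential]
    refine Finset.sum_eq_zero fun i _ => ?_
    obtain ⟨l, hl⟩ := exists_ne k
    obtain ⟨j, hjk, hj⟩ := hcon i l hl
    exact Finset.prod_eq_zero (Finset.mem_univ j) (by
      rw [Pi.single_eq_of_ne hjk, zero_pow (by omega)])
  · rw [eval_pderiv_potential]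
    refine Finset.sum_eq_zero fun i _ => ?_
    by_cases hlk : l = k
    · subst hlk
      obtain ⟨l', hl'⟩ := exists_ne l
      obtain ⟨j, hjk, hj⟩ := hcon i l' hl'
      rw [Finset.prod_eq_zero (Finset.mem_univ j), mul_zero]
      rw [Pi.single_eq_of_ne hjk, if_neg hjk, zero_pow (by omega)]
    · obtain ⟨j, hjk, hj⟩ := hcon i l hlk
      rw [Finset.prod_eq_zero (Finset.mem_univ j), mul_zero]
      rw [Pi.single_eq_of_ne hjk, zero_pow (by omega)]

theorem add_lt_sum_of_three_le_card (hcard : 3 ≤ Fintype.card ι) {q : ι → ℕ}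
    (hqpos : ∀ j, 0 < q j) {k l : ι} (hlk : l ≠ k) : q k + q l < ∑ j, q j := by
  obtain ⟨m, hm⟩ : ∃ m, m ∉ ({k, l} : Finset ι) := by
    by_contra! h
    have := Finset.card_le_card (fun x _ => h x : (Finset.univ : Finset ι) ⊆ {k, l})
    rw [Finset.card_univ] at this
    exact absurd (this.trans Finset.card_le_two) (by omega)
  have h := Finset.sum_le_sum_of_subset (f := q) (Finset.subset_univ (insert m {k, l}))
  rw [Finset.sum_insert hm, Finset.sum_pair hlk.symm] at h
  have := hqpos m
  omega

/-- The shape of the exponent matrix of a nondegenerate Calabi–Yau polynomial: up to a permutation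
`σ` of the rows, the `k`-th monomial is a power of `x_k` of exponent at least two, multiplied by at
most one further variable `x_(l k)`. -/
structure IsInvertibleType (A : Matrix ι ι ℕ) (σ : ι ≃ ι) (l : ι → ι) : Prop where
  ne : ∀ k, l k ≠ k
  two_le : ∀ k, 2 ≤ A (σ k) k
  le : ∀ k j, j ≠ k → A (σ k) j ≤ if j = l k then 1 else 0

/-- Nondegeneracy attaches a row to each variable. If the exponent of `x_k` in its row were at most
one, the degree would be at most `q_k + q_(l k)`, which is less than `∑ q_j = d` when there are
three variables. Exponents of at least two make the assignment injective: in the row of `k` every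
other exponent is at most one. -/
theorem exists_isInvertibleType (hnd : IsNondegenerate A) (hcard : 3 ≤ Fintype.card ι)
    {q : ι → ℕ} {d : ℕ} (hqpos : ∀ j, 0 < q j) (hq : IsWeightSystem A q d)
    (hCY : ∑ j, q j = d) : ∃ σ l, IsInvertibleType A σ l := by
  have : Nontrivial ι := Fintype.one_lt_card_iff_nontrivial.mp (by omega)
  choose σ l hlk hl using exists_row_of_isNondegenerate hnd
  have htwo : ∀ k, 2 ≤ A (σ k) k := by
    intro k
    by_contra! h
    have hle : ∑ j, A (σ k) j * q j ≤ ∑ j ∈ {k, l k}, q j := by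
      rw [← Finset.sum_subset (Finset.subset_univ {k, l k})]
      · refine Finset.sum_le_sum fun j _ => ?_
        have : A (σ k) j ≤ 1 := by
          by_cases hj : j = k
          · subst hj; omega
          · exact (hl k j hj).trans (by split_ifs <;> omega)
        nlinarith
      · intro j _ hj
        rw [Finset.mem_insert, Finset.mem_singleton, not_or] at hj
        have := hl k j hj.1
        rw [if_neg hj.2, Nat.le_zero] at this
        rw [this, zero_mul]
    rw [hq, Finset.sum_pair (hlk k).symm, ← hCY] at hle
    exact absurd (add_lt_sum_of_three_le_card hcard hqpos (hlk k)) (by omega)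
  have hinj : Function.Injective σ := by
    intro k k' hkk
    by_contra hne
    have h1 := hl k k' (Ne.symm hne)
    have h2 := htwo k'
    rw [hkk] at h1
    split_ifs at h1 <;> omega
  exact ⟨Equiv.ofBijective σ (Finite.injective_iff_bijective.mp hinj), l, hlk, htwo, hl⟩

variable {σ : ι ≃ ι} {l : ι → ι}

omit [Fintype ι] in
theorem IsInvertibleType.eq_one (h : IsInvertibleType A σ l) {k j : ι} (hjk : j ≠ k)
    (hj : A (σ k) j ≠ 0) : A (σ k) j = 1 ∧ j = l k := by
  have := h.le k j hjk
  split_ifs at this with h1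
  · exact ⟨by omega, h1⟩
  · omega

/-- In a nondegenerate polynomial no variable is attached to two different powers. -/
theorem IsInvertibleType.unique (h : IsInvertibleType A σ l) (hnd : IsNondegenerate A)
    {j k k' : ι} (hkk : k ≠ k') (hjk : j ≠ k) (hjk' : j ≠ k') (hk : A (σ k) j ≠ 0)
    (hk' : A (σ k') j ≠ 0) : False := by
  obtain ⟨hk1, hlk⟩ := h.eq_one hjk hk
  obtain ⟨hk1', hlk'⟩ := h.eq_one hjk' hk'
  -- The singular point has `x_k = 1`, `x_k' = ζ` and zeros elsewhere. Only the derivative along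
  -- `x_j` could fail to vanish there; its value is `1 + ζ ^ A (σ k') k' = 0`.
  obtain ⟨ζ, hζ⟩ := IsAlgClosed.exists_pow_nat_eq (-1 : ℂ)
    (show 0 < A (σ k') k' from (h.two_le k').trans_lt' two_pos)
  let x : ι → ℂ := fun m => if m = k then 1 else if m = k' then ζ else 0
  have hxk : x k = 1 := by simp [x]
  have hxk' : x k' = ζ := by simp [x, hkk.symm]
  have hx0 : ∀ m, m ≠ k → m ≠ k' → x m = 0 := fun m h1 h2 => by simp [x, h1, h2]
  have hxne : x ≠ 0 := fun hx => by
    have := congrFun hx k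
    rw [hxk] at this
    exact one_ne_zero this
  refine hxne ((hnd x).mp ⟨?_, fun p => ?_⟩)
  · rw [eval_potential, ← Equiv.sum_comp σ]
    refine Finset.sum_eq_zero fun m _ => ?_
    by_cases hm : m = k
    · subst hm
      exact Finset.prod_eq_zero (Finset.mem_univ j) (by rw [hx0 j hjk hjk', zero_pow hk])
    by_cases hm' : m = k'
    · subst hm'
      exact Finset.prod_eq_zero (Finset.mem_univ j) (by rw [hx0 j hjk hjk', zero_pow hk'])
    have := h.two_le m
    exact Finset.prod_eq_zero (Finset.mem_univ m) (by rw [hx0 m hm hm', zero_pow (by omega)])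
  · rw [eval_pderiv_potential, ← Equiv.sum_comp σ]
    -- The other monomials contain the square of a vanishing variable, so they survive no single
    -- differentiation.
    have hrest : ∀ m, m ≠ k → m ≠ k' →
        (A (σ m) p : ℂ) * ∏ j, x j ^ (A (σ m) j - if j = p then 1 else 0) = 0 := by
      intro m hm hm'
      have := h.two_le m
      rw [Finset.prod_eq_zero (Finset.mem_univ m), mul_zero]
      rw [hx0 m hm hm', zero_pow]
      split_ifs <;> omega
    by_cases hp : p = j
    · subst hp
      have hval : ∀ m, (m = k ∨ m = k') → A (σ m) p = 1 → p = l m → p ≠ m →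
          (A (σ m) p : ℂ) * ∏ j, x j ^ (A (σ m) j - if j = p then 1 else 0) =
            x m ^ A (σ m) m := by
        intro m hm h1 h2 h3
        rw [h1, Nat.cast_one, one_mul, Finset.prod_eq_single m]
        · rw [if_neg h3.symm, Nat.sub_zero]
        · intro b _ hb
          have := h.le m b hb
          rw [← h2] at this
          rw [Nat.sub_eq_zero_of_le this, pow_zero]
        · simp
      rw [← Finset.sum_subset (Finset.subset_univ {k, k'}), Finset.sum_pair hkk,
        hval k (Or.inl rfl) hk1 hlk hjk, hval k' (Or.inr rfl) hk1' hlk' hjk', hxk, hxk', hζ,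
        one_pow, add_neg_cancel]
      intro m _ hm
      rw [Finset.mem_insert, Finset.mem_singleton, not_or] at hm
      exact hrest m hm.1 hm.2
    · refine Finset.sum_eq_zero fun m _ => ?_
      by_cases hm : m = k ∨ m = k'
      · rw [Finset.prod_eq_zero (Finset.mem_univ j), mul_zero]
        rw [hx0 j hjk hjk', if_neg (Ne.symm hp), Nat.sub_zero, zero_pow]
        rcases hm with rfl | rfl
        exacts [hk, hk']
      · rw [not_or] at hm
        exact hrest m hm.1 hm.2

/-- A monomial involves at most the two variables `x_k` and `x_(l k)`. For the transposed matrix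
this is the zero in every column that the embedding requires. -/
theorem IsInvertibleType.exists_row_eq_zero (h : IsInvertibleType A σ l)
    (hcard : 3 ≤ Fintype.card ι) (i : ι) : ∃ j, A i j = 0 := by
  obtain ⟨k, rfl⟩ := σ.surjective i
  by_contra! hcon
  have : (Finset.univ : Finset ι) ⊆ {k, l k} := by
    intro j _
    rw [Finset.mem_insert, Finset.mem_singleton]
    by_contra! hj
    exact hj.2 (h.eq_one hj.1 (hcon j)).2
  have := (Finset.card_le_card this).trans Finset.card_le_two
  rw [Finset.card_univ] at this
  omega

/-- A column without zeros would attach its variable to the powers of two further variables. -/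
theorem IsInvertibleType.exists_column_eq_zero (h : IsInvertibleType A σ l)
    (hnd : IsNondegenerate A) (hcard : 3 ≤ Fintype.card ι) (j : ι) : ∃ i, A i j = 0 := by
  by_contra! hcon
  have h1 : 1 < (Finset.univ.erase j).card := by
    rw [Finset.card_erase_of_mem (Finset.mem_univ j), Finset.card_univ]
    omega
  obtain ⟨k, hk, k', hk', hkk⟩ := Finset.one_lt_card.mp h1
  exact h.unique hnd hkk (Finset.ne_of_mem_erase hk).symm (Finset.ne_of_mem_erase hk').symm
    (hcon _) (hcon _)

/-- The weights of the transposed polynomial are positive. -/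
theorem IsInvertibleType.weight_pos (h : IsInvertibleType A σ l)
    (hnd : IsNondegenerate A) {d : ℕ} (hd : 0 < d) {r : ι → ℤ}
    (hr : ∀ j, ∑ i, (A i j : ℤ) * r i = d) (i : ι) : 0 < r i := by
  -- Column `j` contains the exponent of the power of `x_j` and, by uniqueness, at most one more
  -- nonzero entry, which equals `1`.
  have hstep : ∀ j, (A (σ j) j : ℤ) * r (σ j) = d ∨
      ∃ p, (A (σ j) j : ℤ) * r (σ j) + r (σ p) = d := by
    intro j
    have hj := hr j
    rw [← Equiv.sum_comp σ, ← Finset.add_sum_erase _ _ (Finset.mem_univ j)] at hj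
    by_cases hp : ∃ p, p ≠ j ∧ A (σ p) j ≠ 0
    · obtain ⟨p, hpj, hp⟩ := hp
      right
      refine ⟨p, ?_⟩
      rw [Finset.sum_eq_single p, (h.eq_one hpj.symm hp).1, Nat.cast_one, one_mul] at hj
      · exact hj
      · intro k hk hkp
        have : A (σ k) j = 0 := by
          by_contra hne
          exact h.unique hnd hkp (Finset.ne_of_mem_erase hk).symm hpj.symm hne hp
        rw [this, Nat.cast_zero, zero_mul]
      · intro hp'
        exact absurd (Finset.mem_erase.mpr ⟨hpj, Finset.mem_univ p⟩) hp'
    · left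
      push Not at hp
      rw [Finset.sum_eq_zero, add_zero] at hj
      · exact hj
      · intro k hk
        rw [hp k (Finset.ne_of_mem_erase hk), Nat.cast_zero, zero_mul]
  have : Nonempty ι := ⟨i⟩
  obtain ⟨j, hj⟩ := Finite.exists_min fun j => r (σ j)
  obtain ⟨m, hm⟩ := Finite.exists_max fun j => r (σ j)
  have hd' : (0 : ℤ) < d := by exact_mod_cast hd
  have haj : (2 : ℤ) ≤ A (σ j) j := by exact_mod_cast h.two_le j
  have ham : (2 : ℤ) ≤ A (σ m) m := by exact_mod_cast h.two_le m
  -- If the minimum `r_min` were not positive, its equation would give `r_max ≥ d - 2 r_min ≥ d`.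
  -- The equation of the maximum would then either fail or produce a value of at most `d - 2 r_max ≤
  -- -d + 4 r_min`, which is below the minimum.
  have hpos : 0 < r (σ j) := by
    by_contra! hneg
    rcases hstep j with h1 | ⟨p, h1⟩
    · nlinarith
    · have h2 : r (σ p) ≥ d - 2 * r (σ j) := by nlinarith
      have h3 := hm p
      have h4 : 0 < r (σ m) := by linarith
      have h5 : 2 * r (σ m) ≤ A (σ m) m * r (σ m) := by nlinarith
      rcases hstep m with h6 | ⟨p', h6⟩
      · linarith
      · have := hj p'
        linarith
  have := hj (σ.symm i)
  rw [Equiv.apply_symm_apply] at this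
  exact hpos.trans_le this

end Nondegenerate

/-! ### The dual group, the orthogonal complement and their inclusions -/

section Dual

variable {ι : Type} [Fintype ι] {A : Matrix ι ι ℕ} {B : Matrix ι ι ℤ} {d : ℕ} {q : ι → ℕ}
  {G : Subgroup (ι → ℂˣ)}

/-- The product of the `(ρ_i^T) ^ (s_i)` is `pr d` of `sB`, and the invariance of a monomial can be
tested at the point with all coordinates `1`. -/
theorem mem_dualGroup_iff {g : ι → ℂˣ} :
    g ∈ dualGroup d B G ↔
      ∃ s : ι → ℤ, (∀ l ∈ G, character l s = 1) ∧ pr d (Matrix.vecMul s B) = g := by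
  refine exists_congr fun s => and_congr ?_ (Eq.congr_left ?_)
  · refine forall₂_congr fun l _ => ?_
    constructor
    · intro h
      simpa [character] using h 1
    · intro h x
      rw [← character, ← character]
      exact (character_mul l x s).trans (by rw [h, one_mul])
  · funext j
    rw [Finset.prod_apply, pr_apply, Matrix.vecMul, dotProduct, rootChar_sum]
    refine Finset.prod_congr rfl fun i _ => ?_
    rw [Pi.pow_apply, pr_apply, ← rootChar_mul]

theorem pr_eq_pr_iff {κ : Type} (hd : 0 < d) (s t : κ → ℤ) :
    pr d s = pr d t ↔ ∀ j, (d : ℤ) ∣ s j - t j := by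
  rw [funext_iff]
  refine forall_congr' fun j => ?_
  rw [pr_apply, pr_apply, ← rootChar_eq_one_iff hd, sub_eq_add_neg, rootChar_add, rootChar_neg,
    mul_inv_eq_one]

theorem character_const_of_le_diagSL (hG : G ≤ diagSL A) (x : ℤ) {l : ι → ℂˣ} (hl : l ∈ G) :
    character l (fun _ => x) = 1 := by
  rw [character, Finset.prod_zpow, (hG hl).2, one_zpow]

variable [DecidableEq ι]

/-- A vector lies in the orthogonal complement of `pr⁻¹(H)` exactly if the corresponding Laurent
monomial is `G`-invariant. -/
theorem forall_dvd_iff_character_eq_one (hd : 0 < d)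
    (hAB : A.map (Nat.cast : ℕ → ℤ) * B = (d : ℤ) • 1)
    (hBA : B * A.map (Nat.cast : ℕ → ℤ) = (d : ℤ) • 1) (hG : G ≤ diagAut A) (s : ι → ℤ) :
    (∀ h : ι → ℤ, pr d h ∈ shiodaPreimage d B G → (d : ℤ) ∣ s ⬝ᵥ B.mulVec h) ↔
      ∀ l ∈ G, character l s = 1 := by
  constructor
  · intro h l hl
    obtain ⟨v, rfl⟩ := exists_shiodaPush_pr_eq hd hAB hBA (hG hl)
    rw [shiodaPush_pr, character_pr, rootChar_eq_one_iff hd]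
    exact h v ⟨pr_mem_diagAut_fermat hd v, hl⟩
  · intro h v hv
    rw [← rootChar_eq_one_iff hd, ← character_pr, ← shiodaPush_pr]
    exact h _ hv.2

theorem mem_orthCompl_iff (hd : 0 < d)
    (hAB : A.map (Nat.cast : ℕ → ℤ) * B = (d : ℤ) • 1)
    (hBA : B * A.map (Nat.cast : ℕ → ℤ) = (d : ℤ) • 1) (hG : G ≤ diagAut A) {g : ι → ℂˣ} :
    g ∈ orthCompl d B (shiodaPreimage d B G) ↔
      ∃ s : ι → ℤ, (∀ l ∈ G, character l s = 1) ∧ pr d s = g :=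
  exists_congr fun s => and_congr (forall_dvd_iff_character_eq_one hd hAB hBA hG s) Iff.rfl

/-- The orthogonal complement of the preimage of `G` is the preimage of the dual group. -/
theorem orthCompl_shiodaPreimage (hd : 0 < d)
    (hAB : A.map (Nat.cast : ℕ → ℤ) * B = (d : ℤ) • 1)
    (hBA : B * A.map (Nat.cast : ℕ → ℤ) = (d : ℤ) • 1) (hG : G ≤ diagAut A) :
    orthCompl d B (shiodaPreimage d B G) = shiodaPreimage d B.transpose (dualGroup d B G) := by
  ext g
  rw [mem_orthCompl_iff hd hAB hBA hG]
  constructor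
  · rintro ⟨s, hs, rfl⟩
    refine ⟨pr_mem_diagAut_fermat hd s, ?_⟩
    change shiodaPush B.transpose (pr d s) ∈ dualGroup d B G
    rw [shiodaPush_pr, Matrix.mulVec_transpose]
    exact mem_dualGroup_iff.mpr ⟨s, hs, rfl⟩
  · rintro ⟨hg, hgG⟩
    obtain ⟨t, rfl⟩ := exists_pr_eq hd ((mem_diagAut_fermat_iff hd g).mp hg)
    change shiodaPush B.transpose (pr d t) ∈ dualGroup d B G at hgG
    rw [shiodaPush_pr, Matrix.mulVec_transpose, mem_dualGroup_iff] at hgG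
    obtain ⟨s, hs, hst⟩ := hgG
    refine ⟨t, fun l hl => ?_, rfl⟩
    -- The vectors `s` and `t` need not agree, but `(s - t)B` is divisible by `d`. Hence `s - t` is
    -- an integral combination of rows of `A`, and these are `G`-invariant exponents.
    choose u hu using (pr_eq_pr_iff hd _ _).mp hst
    have hu' : Matrix.vecMul (s - t) B = (d : ℤ) • u := by
      rw [Matrix.sub_vecMul]
      exact funext hu
    have hd' : (d : ℤ) ≠ 0 := by exact_mod_cast hd.ne'
    have hst' : s - t = Matrix.vecMul u (A.map (Nat.cast : ℕ → ℤ)) := by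
      refine smul_right_injective (ι → ℤ) hd' ?_
      change (d : ℤ) • (s - t) = (d : ℤ) • Matrix.vecMul u (A.map (Nat.cast : ℕ → ℤ))
      rw [← Matrix.smul_vecMul, ← hu', Matrix.vecMul_vecMul, hBA, Matrix.vecMul_smul,
        Matrix.vecMul_one]
    have h1 : character l (s - t) = 1 := by
      rw [hst', character_vecMul]
      refine Finset.prod_eq_one fun i _ => ?_
      have := (mem_diagAut_iff (rows_injective_of_mul_eq hd hAB) l).mp (hG hl) i
      change character l (A.map (Nat.cast : ℕ → ℤ) i) = 1 at this
      rw [this, one_zpow]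
    have h2 := character_add l (s - t) t
    rw [sub_add_cancel, hs l hl, h1, one_mul] at h2
    exact h2.symm

/-- This is the element of `J_{F_A}` with parameter `exp (2πi / d)`. -/
theorem pr_weight_mem_expGrp (hd : 0 < d)
    (hAB : A.map (Nat.cast : ℕ → ℤ) * B = (d : ℤ) • 1) (hq : IsWeightSystem A q d) :
    pr d (fun j => (q j : ℤ)) ∈ expGrp A q := by
  constructor
  · refine (mem_diagAut_iff (rows_injective_of_mul_eq hd hAB) _).mpr fun i => ?_
    rw [character_pr, rootChar_eq_one_iff hd]
    have h : (fun j => (A i j : ℤ)) ⬝ᵥ (fun j => (q j : ℤ)) = d := by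
      simpa [dotProduct] using congrArg (Nat.cast : ℕ → ℤ) (hq i)
    rw [h]
  · refine ⟨rootChar d 1, funext fun j => ?_⟩
    change rootChar d 1 ^ q j = rootChar d (q j : ℤ)
    rw [← zpow_natCast, ← rootChar_mul, mul_one]

/-- For an element `pr d (sB)`, invariance of `F_{A^T}` is the identity `sBA = ds`. Its determinant
is the value of the `s`-monomial at the element `exp (2πi q_j / d)` of `J_{F_A} ≤ G`, hence `1`. -/
theorem dualGroup_le_diagSL (hd : 0 < d)
    (hAB : A.map (Nat.cast : ℕ → ℤ) * B = (d : ℤ) • 1)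
    (hBA : B * A.map (Nat.cast : ℕ → ℤ) = (d : ℤ) • 1) (hq : IsWeightSystem A q d)
    (hBAT : A.transpose.map (Nat.cast : ℕ → ℤ) * B.transpose = (d : ℤ) • 1)
    (hJG : expGrp A q ≤ G) : dualGroup d B G ≤ diagSL A.transpose := by
  intro g hg
  obtain ⟨s, hs, rfl⟩ := mem_dualGroup_iff.mp hg
  constructor
  · refine (mem_diagAut_iff (rows_injective_of_mul_eq hd hBAT) _).mpr fun i => ?_
    rw [character_pr, rootChar_eq_one_iff hd, dotProduct_comm]
    have h : Matrix.vecMul (Matrix.vecMul s B) (A.map (Nat.cast : ℕ → ℤ)) i = d * s i := by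
      rw [Matrix.vecMul_vecMul, hBA, Matrix.vecMul_smul, Matrix.vecMul_one]
      rfl
    exact ⟨s i, h⟩
  · have h := hs _ (hJG (pr_weight_mem_expGrp hd hAB hq))
    rw [character_pr] at h
    simp only [pr_apply]
    rw [← rootChar_sum, ← dotProduct_weight hd hBA hq]
    exact h

/-- The parameter `t` is a `d`-th root of unity and the `r_j` are the column sums of `B`, so the
element comes from a constant exponent vector. The corresponding monomial is a power of `∏ x_i`,
invariant because `G` has determinant one. -/
theorem expGrp_transpose_le_dualGroup (hd : 0 < d)
    (hBAT : A.transpose.map (Nat.cast : ℕ → ℤ) * B.transpose = (d : ℤ) • 1) {r : ι → ℕ}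
    (hr : IsWeightSystem A.transpose r d) (hrB : ∀ j, (r j : ℤ) = ∑ i, B i j) [Nonempty ι]
    (hGSL : G ≤ diagSL A) : expGrp A.transpose r ≤ dualGroup d B G := by
  rintro _ ⟨hg, t, rfl⟩
  have ht : t ^ d = 1 := by
    obtain ⟨i⟩ := ‹Nonempty ι›
    have h := (mem_diagAut_iff (rows_injective_of_mul_eq hd hBAT) _).mp hg i
    have h' : character (fun j => t ^ r j) (fun j => (A.transpose i j : ℤ)) = t ^ d := by
      rw [← hr i, character, ← Finset.prod_pow_eq_pow_sum]
      refine Finset.prod_congr rfl fun j _ => ?_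
      rw [zpow_natCast, ← pow_mul, mul_comm]
    exact h'.symm.trans h
  obtain ⟨x, rfl⟩ := exists_rootChar_eq hd ht
  refine mem_dualGroup_iff.mpr ⟨fun _ => x, fun l hl => character_const_of_le_diagSL hGSL x hl,
    funext fun j => ?_⟩
  change rootChar d (Matrix.vecMul (fun _ => x) B j) = rootChar d x ^ r j
  rw [← zpow_natCast, ← rootChar_mul, hrB, Matrix.vecMul, dotProduct, ← Finset.mul_sum, mul_comm]

theorem exists_eq_const_of_mem_expGrp_fermat {g : ι → ℂˣ} (hg : g ∈ expGrp (fermat d) 1) :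
    g ∈ diagAut (fermat d) ∧ ∃ t : ℂˣ, g = fun _ => t := by
  obtain ⟨hg, t, rfl⟩ := hg
  exact ⟨hg, t, funext fun j => pow_one t⟩

/-- The Shioda map sends the constant vector `t` to `(t ^ q_j)_j`, because the row sums of `B` are
the weights. -/
theorem expGrp_fermat_le_shiodaPreimage (hd : 0 < d)
    (hAB : A.map (Nat.cast : ℕ → ℤ) * B = (d : ℤ) • 1)
    (hBA : B * A.map (Nat.cast : ℕ → ℤ) = (d : ℤ) • 1) (hq : IsWeightSystem A q d)
    (hJG : expGrp A q ≤ G) : expGrp (fermat d) 1 ≤ shiodaPreimage d B G := by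
  intro g hg
  obtain ⟨hg, t, rfl⟩ := exists_eq_const_of_mem_expGrp_fermat hg
  refine ⟨hg, hJG ⟨shiodaPush_mem_diagAut hd hAB hg, t, funext fun j => ?_⟩⟩
  rw [shiodaPush_apply, character_const]
  have h := congrFun (mulVec_one_eq_weight hd hBA hq) j
  rw [Matrix.mulVec, dotProduct_one] at h
  rw [h, zpow_natCast]
  rfl

/-- Scalars correspond to constant exponent vectors, which are invariant because `G` has determinant
one. -/
theorem expGrp_fermat_le_orthCompl (hd : 0 < d)
    (hAB : A.map (Nat.cast : ℕ → ℤ) * B = (d : ℤ) • 1)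
    (hBA : B * A.map (Nat.cast : ℕ → ℤ) = (d : ℤ) • 1) (hGSL : G ≤ diagSL A) [Nonempty ι] :
    expGrp (fermat d) 1 ≤ orthCompl d B (shiodaPreimage d B G) := by
  intro g hg
  obtain ⟨hg, t, rfl⟩ := exists_eq_const_of_mem_expGrp_fermat hg
  obtain ⟨i⟩ := ‹Nonempty ι›
  obtain ⟨x, rfl⟩ := exists_rootChar_eq hd ((mem_diagAut_fermat_iff hd _).mp hg i)
  exact (mem_orthCompl_iff hd hAB hBA fun l hl => (hGSL hl).1).mpr
    ⟨fun _ => x, fun l hl => character_const_of_le_diagSL hGSL x hl, rfl⟩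

theorem map_mul_eq_smul_one (hA : IsUnit (A.map (Nat.cast : ℕ → ℚ)))
    (hB : B.map (Int.cast : ℤ → ℚ) = (d : ℚ) • (A.map (Nat.cast : ℕ → ℚ))⁻¹) :
    A.map (Nat.cast : ℕ → ℤ) * B = (d : ℤ) • 1 ∧ B * A.map (Nat.cast : ℕ → ℤ) = (d : ℤ) • 1 := by
  have hdet := (Matrix.isUnit_iff_isUnit_det _).mp hA
  have hinj : Function.Injective fun M : Matrix ι ι ℤ => M.map (Int.cast : ℤ → ℚ) :=
    Matrix.map_injective Int.cast_injective
  have hA' : (A.map (Nat.cast : ℕ → ℤ)).map (Int.cast : ℤ → ℚ) = A.map (Nat.cast : ℕ → ℚ) := by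
    ext i j
    simp
  have hone : ((d : ℤ) • (1 : Matrix ι ι ℤ)).map (Int.cast : ℤ → ℚ) = (d : ℚ) • 1 := by
    ext i j
    rw [Matrix.map_apply, Matrix.smul_apply, Matrix.smul_apply, Matrix.one_apply, Matrix.one_apply]
    split_ifs <;> simp
  have hmul : ∀ M N : Matrix ι ι ℤ, (M * N).map (Int.cast : ℤ → ℚ) =
      M.map (Int.cast : ℤ → ℚ) * N.map (Int.cast : ℤ → ℚ) := fun M N =>
    Matrix.map_mul (f := Int.castRingHom ℚ)
  constructor
  · refine hinj ?_
    beta_reduce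
    rw [hmul, hA', hB, hone, Matrix.mul_smul, Matrix.mul_nonsing_inv _ hdet]
  · refine hinj ?_
    beta_reduce
    rw [hmul, hA', hB, hone, Matrix.smul_mul, Matrix.nonsing_inv_mul _ hdet]

end Dual

end BHK

/-! ### The two birational equivalences -/

theorem corollary3p2 (n : ℕ) (hn : 2 ≤ n)
    (A : Matrix (Fin (n + 1)) (Fin (n + 1)) ℕ)
    (hA : IsUnit (A.map (Nat.cast : ℕ → ℚ)))
    (d : ℕ) (hd : 0 < d)
    (B : Matrix (Fin (n + 1)) (Fin (n + 1)) ℤ)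
    (hB : B.map (Int.cast : ℤ → ℚ) = (d : ℚ) • (A.map (Nat.cast : ℕ → ℚ))⁻¹)
    (q : Fin (n + 1) → ℕ) (hqpos : ∀ j, 0 < q j) (hq : BHK.IsWeightSystem A q d)
    (hnd : BHK.IsNondegenerate A)
    (hCY : ∑ j, q j = d)
    (G : Subgroup (Fin (n + 1) → ℂˣ))
    (hJG : BHK.expGrp A q ≤ G) (hGSL : G ≤ BHK.diagSL A) :
    -- the first quotient
    BHK.expGrp (BHK.fermat d) 1 ≤ BHK.shiodaPreimage d B G ∧
    AlgebraicGeometry.Scheme.BirationalOver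
      (BHK.orbifoldToSpec A q d hq G)
      (BHK.orbifoldToSpec (BHK.fermat d) 1 d (BHK.isWeightSystem_fermat d)
        (BHK.shiodaPreimage d B G)) ∧
    -- the mirror, a quotient of a hypersurface with the weights `r_j = ∑ i, b_ij`
    ∃ (r : Fin (n + 1) → ℕ) (hr : BHK.IsWeightSystem A.transpose r d),
      (∀ j, 0 < r j ∧ (r j : ℤ) = ∑ i, B i j) ∧
      BHK.expGrp A.transpose r ≤ BHK.dualGroup d B G ∧
      BHK.dualGroup d B G ≤ BHK.diagSL A.transpose ∧
      BHK.expGrp (BHK.fermat d) 1 ≤ BHK.orthCompl d B (BHK.shiodaPreimage d B G) ∧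
      AlgebraicGeometry.Scheme.BirationalOver
        (BHK.orbifoldToSpec A.transpose r d hr (BHK.dualGroup d B G))
        (BHK.orbifoldToSpec (BHK.fermat d) 1 d (BHK.isWeightSystem_fermat d)
          (BHK.orthCompl d B (BHK.shiodaPreimage d B G))) := by
  obtain ⟨hAB, hBA⟩ := BHK.map_mul_eq_smul_one hA hB
  have hABT : A.transpose.map (Nat.cast : ℕ → ℤ) * B.transpose = (d : ℤ) • 1 := by
    rw [Matrix.transpose_map, ← Matrix.transpose_mul, hBA, Matrix.transpose_smul,
      Matrix.transpose_one]
  have hBAT : B.transpose * A.transpose.map (Nat.cast : ℕ → ℤ) = (d : ℤ) • 1 := by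
    rw [Matrix.transpose_map, ← Matrix.transpose_mul, hAB, Matrix.transpose_smul,
      Matrix.transpose_one]
  have hcard : 3 ≤ Fintype.card (Fin (n + 1)) := by
    rw [Fintype.card_fin]
    omega
  have : Nontrivial (Fin (n + 1)) := Fintype.one_lt_card_iff_nontrivial.mp (by omega)
  obtain ⟨σ, l, hinv⟩ := BHK.exists_isInvertibleType hnd hcard hqpos hq hCY
  refine ⟨BHK.expGrp_fermat_le_shiodaPreimage hd hAB hBA hq hJG,
    BHK.birationalOver_fermat hd hAB hBA hq hqpos (hinv.exists_column_eq_zero hnd hcard) G, ?_⟩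
  -- The column sums of `B` form the all-ones row vector times `B`, and `BA = dI`.
  have hrA : ∀ j, ∑ i, (A i j : ℤ) * ∑ k, B k i = d := by
    intro j
    have h : Matrix.vecMul (Matrix.vecMul 1 B) (A.map (Nat.cast : ℕ → ℤ)) j = d := by
      rw [Matrix.vecMul_vecMul, hBA, Matrix.vecMul_smul, Matrix.vecMul_one]
      simp
    rw [← h, Matrix.vecMul, dotProduct]
    refine Finset.sum_congr rfl fun i _ => ?_
    rw [mul_comm, Matrix.vecMul, one_dotProduct, Matrix.map_apply]
  have hpos := hinv.weight_pos hnd hd (r := fun i => ∑ k, B k i) hrA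
  have hrB : ∀ j, ((∑ i, B i j).toNat : ℤ) = ∑ i, B i j := fun j =>
    Int.toNat_of_nonneg (hpos j).le
  have hr : BHK.IsWeightSystem A.transpose (fun j => (∑ i, B i j).toNat) d := by
    intro j
    have h : ∑ i, (A i j : ℤ) * ((∑ k, B k i).toNat : ℤ) = d :=
      (Finset.sum_congr rfl fun i _ => by rw [hrB]).trans (hrA j)
    exact_mod_cast h
  have hrpos : ∀ j, 0 < (∑ i, B i j).toNat := fun j => Int.lt_toNat.mpr (hpos j)
  refine ⟨fun j => (∑ i, B i j).toNat, hr, fun j => ⟨hrpos j, hrB j⟩,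
    BHK.expGrp_transpose_le_dualGroup hd hABT hr hrB hGSL,
    BHK.dualGroup_le_diagSL hd hAB hBA hq hABT hJG,
    BHK.expGrp_fermat_le_orthCompl hd hAB hBA hGSL, ?_⟩
  -- The group is now the preimage of `G^T` under the Shioda map of `Bᵀ`, so the first equivalence
  -- applies to the transposed data.
  rw [BHK.orthCompl_shiodaPreimage hd hAB hBA fun l hl => (hGSL hl).1]
  exact BHK.birationalOver_fermat hd hABT hBAT hr hrpos (hinv.exists_row_eq_zero hcard) _
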